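/- **Theorem (Dependency via point transition).** Let $\mathbb X$ be a measurable space, $P$ a probability measure on $\mathbb X$, $M>0$, and $\rho$ a measure on $(0,\infty)$ with $\rho((0,\infty))=\infty$ and $\int_0^\infty t\,\rho(dt)<\infty$. Let $(J_k,\theta_k)_{k\ge 1}$ be random points forming a Poisson process on $(0,\infty)\times\mathbb X$ with mean (Lévy) measure $\nu(dt,dx)=M\rho(dt)P(dx)$, let $\tilde\mu=\sum_k J_k\delta_{\theta_k}$, and let $$\mu=\frac{\tilde\mu}{\tilde\mu(\mathbb X)}=\sum_k r_k\delta_{\theta_k},\qquad r_k=\frac{J_k}{\sum_j J_j},$$ be the normalized random measure. Let $\mathcal T$ be a probability transition kernel on $\mathbb X$. Given all the points $(J_j,\theta_j)$, let the new locations $\theta'_k\sim\mathcal T(\theta_k,\cdot)$ be drawn independently over $k$, and let $T\mu=\sum_k r_k\delta_{\theta'_k}$ be the point transition of $\mu$. Write $$\tilde\psi(v)=\int_0^\infty(1-e^{-tv})\,\rho(dt),\qquad (\mathcal TP)(D)=\int_{\mathbb X}\mathcal T(x,D)\,P(dx)$$ for the Laplace exponent with the mass removed and for the transformed base measure. Let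 $A,B\subseteq\mathbb X$ be disjoint measurable sets such that the transition moves $B$ to $A$, i.e. $\mathcal T(y,A)=1$ for $P$-almost every $y\in B$. Then $\tilde\psi$ is differentiable on $(0,\infty)$, the integral below is finite, and $$\operatorname{Cov}\bigl(\mu(B),(T\mu)(B)\bigr)=(\mathcal TP)(B)\,P(B)\left(M^2\int_0^\infty\!\!\int_0^{v_2}\tilde\psi'(v_2)^2\,e^{-M\tilde\psi(v_2)}\,dv_1\,dv_2-1\right).$$ In particular, if the points moved into $B$ are exactly those of a measurable set $C$ (that is, $\mathcal T(x,B)=\mathbf 1_C(x)$ for $P$-almost every $x$), then $(\mathcal TP)(B)=P(C)$ and $$\operatorname{Cov}\bigl(\mu(B),(T\mu)(B)\bigr)=P(C)\,P(B)\left(M^2\int_0^\infty\!\!\int_0^{v_2}\tilde\psi'(v_2)^2\,e^{-M\tilde\psi(v_2)}\,dv_1\,dv_2-1\right).$$ -/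

import Mathlib

open MeasureTheory ProbabilityTheory Set
open scoped ENNReal

noncomputable section

/-- The counting measure `N = ∑ₖ δ_{Z k}` of a sequence of random points `Z k` of `S`. -/
def countingMeasure {Ω S : Type*} [MeasurableSpace S] (Z : ℕ → Ω → S) (ω : Ω) : Measure S :=
  Measure.sum fun k => Measure.dirac (Z k ω)

/-- The random points `Z 0, Z 1, …` form a Poisson process with mean measure `ν`: the number
`N(A)` of points in a measurable set `A` is Poisson with mean `ν(A)` (and a.s. infinite when
`ν(A) = ∞`), and the numbers of points in pairwise disjoint measurable sets are independent. -/
structure IsPoissonProcess {Ω S : Type*} [MeasurableSpace Ω] [MeasurableSpace S]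
    (Pr : Measure Ω) (Z : ℕ → Ω → S) (ν : Measure S) : Prop where
  measurable : ∀ k, Measurable (Z k)
  poisson : ∀ A : Set S, MeasurableSet A → ν A ≠ ∞ → ∀ n : ℕ,
    Pr {ω | countingMeasure Z ω A = n} =
      ENNReal.ofReal (Real.exp (-(ν A).toReal) * (ν A).toReal ^ n / n.factorial)
  infinite : ∀ A : Set S, MeasurableSet A → ν A = ∞ → ∀ᵐ ω ∂Pr, countingMeasure Z ω A = ∞
  indep : ∀ (n : ℕ) (A : Fin n → Set S), (∀ i, MeasurableSet (A i)) →
    Pairwise (fun i j => Disjoint (A i) (A j)) →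
      iIndepFun (fun i ω => countingMeasure Z ω (A i)) Pr

/-- The homogeneous Lévy measure `ν(dt, dx) = M ρ(dt) P(dx)` on `(0, ∞) × X`. Only the part of
`ρ` on `(0, ∞)` is used. -/
def levyMeasure {X : Type*} [MeasurableSpace X] (M : ℝ) (ρ : Measure ℝ) (P : Measure X) :
    Measure (ℝ × X) :=
  ENNReal.ofReal M • (ρ.restrict (Ioi 0)).prod P

/-- The Laplace exponent `ψ(v) = M ∫_{(0,∞)} (1 - e^{-tv}) ρ(dt)`. -/
def laplaceExponent (M : ℝ) (ρ : Measure ℝ) (v : ℝ) : ℝ :=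
  M * ∫ t in Ioi (0 : ℝ), (1 - Real.exp (-(t * v))) ∂ρ

/-- The Laplace exponent with the mass removed, `ψ̃(v) = ψ(v) / M`. -/
def laplaceExponentTilde (M : ℝ) (ρ : Measure ℝ) (v : ℝ) : ℝ :=
  laplaceExponent M ρ v / M

/-- The purely atomic measure `∑ₖ wₖ δ_{xₖ}`. -/
def atomicMeasure {X : Type*} [MeasurableSpace X] (w : ℕ → ℝ≥0∞) (x : ℕ → X) : Measure X :=
  Measure.sum fun k => w k • Measure.dirac (x k)

/-- The random measure `μ̃ = ∑ₖ Jₖ δ_{θₖ}`. -/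
def crm {Ω X : Type*} [MeasurableSpace X] (J : ℕ → Ω → ℝ) (θ : ℕ → Ω → X) (ω : Ω) :
    Measure X :=
  atomicMeasure (fun k => ENNReal.ofReal (J k ω)) (fun k => θ k ω)

/-- `μ̃(B) = ∫_{(0,∞) × B} t N(dt, dx)`, where `N` is the counting measure of the points
`(Jₖ, θₖ)`. -/
theorem crm_apply_eq_lintegral {Ω X : Type*} [MeasurableSpace X] (J : ℕ → Ω → ℝ)
    (θ : ℕ → Ω → X) (ω : Ω) {B : Set X} (hB : MeasurableSet B) :
    crm J θ ω B =
      ∫⁻ z in Ioi 0 ×ˢ B, ENNReal.ofReal z.1 ∂(countingMeasure (fun k ω => (J k ω, θ k ω)) ω) := by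
  classical
  have hS : MeasurableSet (Ioi (0 : ℝ) ×ˢ B) := measurableSet_Ioi.prod hB
  have hf : Measurable (fun z : ℝ × X => ENNReal.ofReal z.1) :=
    ENNReal.measurable_ofReal.comp measurable_fst
  rw [crm, atomicMeasure, countingMeasure, Measure.sum_apply _ hB, ← lintegral_indicator hS,
    lintegral_sum_measure]
  refine tsum_congr fun k => ?_
  rw [lintegral_dirac' _ (hf.indicator hS), Measure.smul_apply, Measure.dirac_apply' _ hB]
  by_cases h1 : θ k ω ∈ B <;> by_cases h2 : 0 < J k ω
  · simp [h1, h2]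
  · simp [h1, h2, ENNReal.ofReal_of_nonpos (not_lt.1 h2)]
  · simp [h1]
  · simp [h1]

/-- The normalized random measure `μ = μ̃ / μ̃(X)`. -/
def nrm {Ω X : Type*} [MeasurableSpace X] (J : ℕ → Ω → ℝ) (θ : ℕ → Ω → X) (ω : Ω) :
    Measure X :=
  (crm J θ ω univ)⁻¹ • crm J θ ω

/-- The normalized jumps `rₖ = Jₖ / ∑ⱼ Jⱼ`. -/
def normalizedJump {Ω : Type*} (J : ℕ → Ω → ℝ) (k : ℕ) (ω : Ω) : ℝ≥0∞ :=
  ENNReal.ofReal (J k ω) / ∑' j, ENNReal.ofReal (J j ω)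

/-- `μ = ∑ₖ rₖ δ_{θₖ}`. -/
theorem nrm_eq_atomicMeasure {Ω X : Type*} [MeasurableSpace X] (J : ℕ → Ω → ℝ)
    (θ : ℕ → Ω → X) (ω : Ω) :
    nrm J θ ω = atomicMeasure (fun k => normalizedJump J k ω) (fun k => θ k ω) := by
  ext B hB
  simp [nrm, crm, atomicMeasure, normalizedJump, Measure.sum_apply, hB, ENNReal.div_eq_inv_mul,
    ← ENNReal.tsum_mul_left, mul_assoc]

/-- Given all the points `(Jⱼ, θⱼ)`, the new locations `θ' k` are drawn independently with
`θ' k ~ 𝒯(θ k, ·)`. -/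
structure IsPointTransition {Ω X : Type*} [MeasurableSpace Ω] [MeasurableSpace X]
    (Pr : Measure Ω) (J : ℕ → Ω → ℝ) (θ : ℕ → Ω → X) (𝒯 : Kernel X X) (θ' : ℕ → Ω → X) :
    Prop where
  measurable : ∀ k, Measurable (θ' k)
  law : ∀ C : Set (ℕ → ℝ × X), MeasurableSet C → ∀ (s : Finset ℕ) (D : ℕ → Set X),
    (∀ k, MeasurableSet (D k)) →
      Pr ({ω | (fun k => (J k ω, θ k ω)) ∈ C} ∩ ⋂ k ∈ s, {ω | θ' k ω ∈ D k}) =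
        ∫⁻ ω in {ω | (fun k => (J k ω, θ k ω)) ∈ C}, ∏ k ∈ s, 𝒯 (θ k ω) (D k) ∂Pr

/-- The point transition `Tμ = ∑ₖ rₖ δ_{θ'ₖ}` of `μ = ∑ₖ rₖ δ_{θₖ}`: the atoms are moved to the
locations `θ'` and the weights are kept. -/
def transitionNrm {Ω X : Type*} [MeasurableSpace X] (J : ℕ → Ω → ℝ) (θ' : ℕ → Ω → X) (ω : Ω) :
    Measure X :=
  atomicMeasure (fun k => normalizedJump J k ω) (fun k => θ' k ω)

/-- The transformed base measure `(𝒯P)(D) = ∫ 𝒯(x, D) P(dx)`. -/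
def transformedBase {X : Type*} [MeasurableSpace X] (𝒯 : Kernel X X) (P : Measure X) :
    Measure X :=
  P.bind 𝒯

theorem transformedBase_apply {X : Type*} [MeasurableSpace X] (𝒯 : Kernel X X) (P : Measure X)
    {D : Set X} (hD : MeasurableSet D) : transformedBase 𝒯 P D = ∫⁻ x, 𝒯 x D ∂P :=
  Measure.bind_apply hD 𝒯.measurable.aemeasurable

end

/-!
Write `S = μ̃(X)` and, for a weight `f : X → [0, 1]`, `U_f = ∑ₖ Jₖ f(θₖ)` (`weightedSum`).
Almost surely `μ(B) = U_f / S` with `f = 1_B`, and the conditional mean of `Tμ(B)` given the points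
is `U_g / S` with `g = 𝒯(·, B)` (`IsPointTransition.lintegral_mul_transitionNrm`). So the
covariance is determined by `E[U_f / S]`, `E[U_g / S]` and `E[U_f U_g / S²]`. Since the transition
moves `B` into a set disjoint from `B`, `f g = 0` holds `P`-almost everywhere.

The quotients are removed by `1 / S = ∫₀^∞ e^{-vS} dv` and `1 / S² = ∫₀^∞ v e^{-vS} dv`, which
leaves moments tilted by `e^{-vS}`. These are one-sided derivatives at `0` of the Laplace functional
`E exp(-U_w) = exp(-M ∫ ψ̃(w) dP)` (`integral_exp_neg_weightedSum`) at weights `w = v + a f + b g`.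
As `f g = 0`, the exponent splits into a part in `a` and a part in `b`, so that
`E[U_f U_g e^{-vS}] = e^{-Mψ̃(v)} (M ψ̃'(v))² ∫ f dP ∫ g dP`
(`integral_weightedSum_mul_weightedSum_mul_exp`), and integration against `v dv` gives the
double integral of the formula. In the first moments the same procedure gives
`E[U_f / S] = c ∫ f dP` with a constant `c`, and `f = 1` shows `c = 1`
(`lintegral_weightedSum_div`).

The Laplace functional is obtained from the Poisson counts for simple functions, by independence
over disjoint level sets, and in general by monotone approximation
(`IsPoissonProcess.lintegral_exp_neg`). The double integral converges because `v ψ̃'(v) ≤ ψ̃(v)`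
(`integrableOn_mul_deriv_sq_mul_exp`).
-/

/-! ### Poisson distributed counts -/

/-- The point probabilities sum to `1`, so a Poisson distributed `Y` with values in `ℝ≥0∞` is
almost surely a natural number, in particular finite. -/
theorem lintegral_comp_eq_tsum_of_poisson {Ω : Type*} [MeasurableSpace Ω] {Pr : Measure Ω}
    [IsProbabilityMeasure Pr] {Y : Ω → ℝ≥0∞} (hY : Measurable Y) {r : ℝ} (hr : 0 ≤ r)
    (h : ∀ n : ℕ, Pr {ω | Y ω = n} = ENNReal.ofReal (Real.exp (-r) * r ^ n / n.factorial))
    (φ : ℝ≥0∞ → ℝ≥0∞) :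
    ∫⁻ ω, φ (Y ω) ∂Pr =
      ∑' n : ℕ, φ n * ENNReal.ofReal (Real.exp (-r) * r ^ n / n.factorial) := by
  have hm : ∀ n : ℕ, MeasurableSet {ω | Y ω = n} := fun n => hY (measurableSet_singleton _)
  have hd : Pairwise (Function.onFun Disjoint fun n : ℕ => {ω | Y ω = n}) := by
    intro i j hij
    refine Set.disjoint_left.2 fun ω hi hj => hij ?_
    simp only [mem_ofPred_eq] at hi hj
    exact_mod_cast hi.symm.trans hj
  have hone : Pr (⋃ n : ℕ, {ω | Y ω = n}) = 1 := by
    rw [measure_iUnion hd hm]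
    simp_rw [h]
    have h1 : HasSum (fun n : ℕ => Real.exp (-r) * r ^ n / n.factorial) 1 :=
      hasSum_one_poissonMeasure ⟨r, hr⟩
    rw [← ENNReal.ofReal_tsum_of_nonneg (fun n => by positivity) h1.summable, h1.tsum_eq,
      ENNReal.ofReal_one]
  have hae : ∀ᵐ ω ∂Pr, ω ∈ ⋃ n : ℕ, {ω | Y ω = n} := by
    rw [← prob_compl_eq_zero_iff (MeasurableSet.iUnion hm)] at hone
    exact measure_eq_zero_iff_ae_notMem.1 hone |>.mono fun ω hω => by simpa using hω
  rw [← Measure.restrict_eq_self_of_ae_mem hae, lintegral_iUnion hm hd]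
  refine tsum_congr fun n => ?_
  rw [setLIntegral_congr_fun (g := fun _ => φ n) (hm n) (fun ω hω => by
    simp only [mem_ofPred_eq] at hω; simp [hω]), setLIntegral_const, h n]

theorem lintegral_eq_of_poisson {Ω : Type*} [MeasurableSpace Ω] {Pr : Measure Ω}
    [IsProbabilityMeasure Pr] {Y : Ω → ℝ≥0∞} (hY : Measurable Y) {r : ℝ} (hr : 0 ≤ r)
    (h : ∀ n : ℕ, Pr {ω | Y ω = n} = ENNReal.ofReal (Real.exp (-r) * r ^ n / n.factorial)) :
    ∫⁻ ω, Y ω ∂Pr = ENNReal.ofReal r := by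
  rw [lintegral_comp_eq_tsum_of_poisson hY hr h fun y => y,
    tsum_eq_zero_add' ENNReal.summable]
  have h1 : ∀ n : ℕ, ((n + 1 : ℕ) : ℝ≥0∞) *
      ENNReal.ofReal (Real.exp (-r) * r ^ (n + 1) / (n + 1).factorial) =
      ENNReal.ofReal (r * (Real.exp (-r) * r ^ n / n.factorial)) := by
    intro n
    rw [← ENNReal.ofReal_natCast, ← ENNReal.ofReal_mul (by positivity)]
    congr 1
    rw [Nat.factorial_succ]
    push_cast
    field_simp
    ring
  simp_rw [h1]
  have h2 : HasSum (fun n : ℕ => r * (Real.exp (-r) * r ^ n / n.factorial)) (r * 1) :=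
    (hasSum_one_poissonMeasure ⟨r, hr⟩).mul_left r
  rw [← ENNReal.ofReal_tsum_of_nonneg (fun n => by positivity) h2.summable, h2.tsum_eq]
  simp

/-- The Laplace transform of the Poisson distribution. The weight `c = ∞` is allowed but carries
the junk value `∞.toReal = 0` on both sides. -/
theorem lintegral_exp_neg_of_poisson {Ω : Type*} [MeasurableSpace Ω] {Pr : Measure Ω}
    [IsProbabilityMeasure Pr] {Y : Ω → ℝ≥0∞} (hY : Measurable Y) {r : ℝ} (hr : 0 ≤ r)
    (h : ∀ n : ℕ, Pr {ω | Y ω = n} = ENNReal.ofReal (Real.exp (-r) * r ^ n / n.factorial))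
    (c : ℝ≥0∞) :
    ∫⁻ ω, ENNReal.ofReal (Real.exp (-(c * Y ω).toReal)) ∂Pr =
      ENNReal.ofReal (Real.exp (-(r * (1 - Real.exp (-c.toReal))))) := by
  rw [lintegral_comp_eq_tsum_of_poisson hY hr h
    (fun y => ENNReal.ofReal (Real.exp (-(c * y).toReal)))]
  have h1 : ∀ n : ℕ, ENNReal.ofReal (Real.exp (-(c * n).toReal)) *
      ENNReal.ofReal (Real.exp (-r) * r ^ n / n.factorial) =
      ENNReal.ofReal (Real.exp (-r) * ((r * Real.exp (-c.toReal)) ^ n / n.factorial)) := by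
    intro n
    rw [← ENNReal.ofReal_mul (by positivity)]
    congr 1
    rw [ENNReal.toReal_mul, ENNReal.toReal_natCast, mul_pow, ← Real.exp_nat_mul]
    rw [show (n : ℝ) * -c.toReal = -(c.toReal * n) by ring]
    ring
  simp_rw [h1]
  have h2 := (NormedSpace.expSeries_div_hasSum_exp (r * Real.exp (-c.toReal))).mul_left
    (Real.exp (-r))
  rw [← ENNReal.ofReal_tsum_of_nonneg (fun n => by positivity) h2.summable, h2.tsum_eq,
    ← Real.exp_eq_exp_ℝ, ← Real.exp_add]
  congr 2
  ring

/-! ### Campbell's formula and the Laplace functional -/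

theorem lintegral_countingMeasure {Ω S : Type*} [MeasurableSpace S] (Z : ℕ → Ω → S) (ω : Ω)
    {F : S → ℝ≥0∞} (hF : Measurable F) :
    ∫⁻ z, F z ∂(countingMeasure Z ω) = ∑' k, F (Z k ω) := by
  simp [countingMeasure, lintegral_sum_measure, lintegral_dirac' _ hF]

section
variable {Ω S : Type*} [MeasurableSpace Ω] [MeasurableSpace S] {Pr : Measure Ω}
  {Z : ℕ → Ω → S} {ν : Measure S}

theorem measurable_countingMeasure_apply (hZ : ∀ k, Measurable (Z k)) {A : Set S}
    (hA : MeasurableSet A) : Measurable fun ω => countingMeasure Z ω A := by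
  simp only [countingMeasure, Measure.sum_apply _ hA, Measure.dirac_apply' _ hA]
  exact Measurable.tsum fun k => (measurable_one.indicator hA).comp (hZ k)

/-- The intensity measure `A ↦ E[N(A)]` is the mean measure `ν`. -/
theorem IsPoissonProcess.sum_map_eq [IsProbabilityMeasure Pr] (h : IsPoissonProcess Pr Z ν) :
    (Measure.sum fun k => Pr.map (Z k)) = ν := by
  ext A hA
  have h1 : (Measure.sum fun k => Pr.map (Z k)) A = ∫⁻ ω, countingMeasure Z ω A ∂Pr := by
    simp only [countingMeasure, Measure.sum_apply _ hA, Measure.dirac_apply' _ hA]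
    rw [lintegral_tsum fun k =>
      show AEMeasurable (fun ω => A.indicator (1 : S → ℝ≥0∞) (Z k ω)) Pr from
        ((measurable_one.indicator hA).comp (h.measurable k)).aemeasurable]
    refine tsum_congr fun k => ?_
    rw [Measure.map_apply (h.measurable k) hA, ← lintegral_indicator_one (h.measurable k hA)]
    rfl
  rw [h1]
  by_cases hν : ν A = ∞
  · rw [lintegral_congr_ae (h.infinite A hA hν), hν]
    simp
  · rw [lintegral_eq_of_poisson (measurable_countingMeasure_apply h.measurable hA)
      ENNReal.toReal_nonneg (h.poisson A hA hν), ENNReal.ofReal_toReal hν]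

/-- **Campbell's formula**. -/
theorem IsPoissonProcess.lintegral_tsum [IsProbabilityMeasure Pr] (h : IsPoissonProcess Pr Z ν)
    {F : S → ℝ≥0∞} (hF : Measurable F) :
    ∫⁻ ω, ∑' k, F (Z k ω) ∂Pr = ∫⁻ z, F z ∂ν := by
  rw [MeasureTheory.lintegral_tsum fun k => show AEMeasurable (fun ω => F (Z k ω)) Pr from
    (hF.comp (h.measurable k)).aemeasurable, ← h.sum_map_eq, lintegral_sum_measure]
  exact tsum_congr fun k => (lintegral_map hF (h.measurable k)).symm

theorem IsPoissonProcess.measurable_tsum (h : IsPoissonProcess Pr Z ν)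
    {F : S → ℝ≥0∞} (hF : Measurable F) : Measurable fun ω => ∑' k, F (Z k ω) :=
  Measurable.tsum fun k => hF.comp (h.measurable k)

theorem IsPoissonProcess.ae_tsum_lt_top [IsProbabilityMeasure Pr] (h : IsPoissonProcess Pr Z ν)
    {F : S → ℝ≥0∞} (hF : Measurable F) (hfin : ∫⁻ z, F z ∂ν ≠ ∞) :
    ∀ᵐ ω ∂Pr, ∑' k, F (Z k ω) < ∞ :=
  ae_lt_top (h.measurable_tsum hF) (by rwa [h.lintegral_tsum hF])

/-- The Laplace functional of `c 1_A`. Only `c * ν A ≠ ∞` is required, so that the zero level set of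
a simple function, which may contain infinitely many points, is covered by `c = 0`. -/
theorem IsPoissonProcess.lintegral_exp_neg_mul_count [IsProbabilityMeasure Pr]
    (h : IsPoissonProcess Pr Z ν) {A : Set S} (hA : MeasurableSet A) {c : ℝ≥0∞}
    (hfin : c * ν A ≠ ∞) :
    ∫⁻ ω, ENNReal.ofReal (Real.exp (-(c * countingMeasure Z ω A).toReal)) ∂Pr =
      ENNReal.ofReal (Real.exp
        (-(ENNReal.ofReal (1 - Real.exp (-c.toReal)) * ν A).toReal)) := by
  rcases eq_or_ne c 0 with rfl | hc
  · simp
  have hν : ν A ≠ ∞ := fun h' => hfin (by rw [h', ENNReal.mul_top hc])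
  rw [lintegral_exp_neg_of_poisson (measurable_countingMeasure_apply h.measurable hA)
      ENNReal.toReal_nonneg (h.poisson A hA hν), ENNReal.toReal_mul, ENNReal.toReal_ofReal,
      mul_comm]
  simp

theorem IsPoissonProcess.lintegral_exp_neg_simpleFunc [IsProbabilityMeasure Pr]
    (h : IsPoissonProcess Pr Z ν) (F : SimpleFunc S ℝ≥0∞) (hfin : ∫⁻ z, F z ∂ν ≠ ∞) :
    ∫⁻ ω, ENNReal.ofReal (Real.exp (-(∑' k, F (Z k ω)).toReal)) ∂Pr =
      ENNReal.ofReal (Real.exp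
        (-(∫⁻ z, ENNReal.ofReal (1 - Real.exp (-(F z).toReal)) ∂ν).toReal)) := by
  let e : Fin F.range.card ≃ F.range := F.range.equivFin.symm
  let c : Fin F.range.card → ℝ≥0∞ := fun i => (e i : ℝ≥0∞)
  let A : Fin F.range.card → Set S := fun i => F ⁻¹' {c i}
  have hA : ∀ i, MeasurableSet (A i) := fun i => F.measurableSet_fiber _
  have hdisj : Pairwise fun i j => Disjoint (A i) (A j) := by
    intro i j hij
    refine Set.disjoint_left.2 fun z hi hj => hij ?_
    simp only [A, mem_preimage, mem_singleton_iff] at hi hj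
    exact e.injective (Subtype.ext (hi.symm.trans hj))
  -- sums over the range of `F` are sums over the index type `Fin _`
  have hsum : ∀ (g : ℝ≥0∞ → ℝ≥0∞) (m : Measure S),
      ∑ x ∈ F.range, g x * m (F ⁻¹' {x}) = ∑ i, g (c i) * m (A i) := by
    intro g m
    rw [← Finset.sum_coe_sort F.range (fun x => g x * m (F ⁻¹' {x}))]
    exact (Equiv.sum_comp e fun x : F.range => g x * m (F ⁻¹' {(x : ℝ≥0∞)})).symm
  have hint : ∀ (g : ℝ≥0∞ → ℝ≥0∞) (m : Measure S),
      ∫⁻ z, g (F z) ∂m = ∑ i, g (c i) * m (A i) := by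
    intro g m
    rw [← hsum, ← SimpleFunc.map_lintegral, ← SimpleFunc.lintegral_eq_lintegral]
    rfl
  have hcfin : ∀ i, c i * ν (A i) ≠ ∞ := by
    have := hint id ν
    simp only [id] at this
    rw [this] at hfin
    exact fun i => (ENNReal.sum_lt_top.1 hfin.lt_top i (Finset.mem_univ i)).ne
  have hN : ∀ ω, ∑' k, F (Z k ω) = ∑ i, c i * countingMeasure Z ω (A i) := by
    intro ω
    rw [← lintegral_countingMeasure Z ω F.measurable]
    exact hint id _
  have hprod : ∀ᵐ ω ∂Pr, ENNReal.ofReal (Real.exp (-(∑' k, F (Z k ω)).toReal)) =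
      ∏ i, ENNReal.ofReal (Real.exp (-(c i * countingMeasure Z ω (A i)).toReal)) := by
    filter_upwards [h.ae_tsum_lt_top F.measurable hfin] with ω hω
    rw [hN] at hω ⊢
    rw [ENNReal.toReal_sum fun i hi => (ENNReal.sum_lt_top.1 hω i hi).ne, ← Finset.sum_neg_distrib,
      Real.exp_sum, ENNReal.ofReal_prod_of_nonneg fun i _ => (Real.exp_pos _).le]
  rw [lintegral_congr_ae hprod]
  have hmeas : ∀ i, Measurable fun x : ℝ≥0∞ => ENNReal.ofReal (Real.exp (-(c i * x).toReal)) :=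
    fun i => by fun_prop
  have hind := (h.indep _ A hA hdisj).comp
    (fun i x => ENNReal.ofReal (Real.exp (-(c i * x).toReal))) hmeas
  rw [lintegral_prod_eq_prod_lintegral_of_indepFun Finset.univ
    (fun i ω => ENNReal.ofReal (Real.exp (-(c i * countingMeasure Z ω (A i)).toReal))) hind
    (fun i => (hmeas i).comp (measurable_countingMeasure_apply h.measurable (hA i)))]
  simp_rw [fun i => h.lintegral_exp_neg_mul_count (hA i) (hcfin i)]
  rw [← ENNReal.ofReal_prod_of_nonneg fun i _ => (Real.exp_pos _).le, ← Real.exp_sum,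
    Finset.sum_neg_distrib, hint (fun x => ENNReal.ofReal (1 - Real.exp (-x.toReal))) ν,
    ENNReal.toReal_sum]
  intro i _
  rcases eq_or_ne (c i) 0 with h0 | h0
  · simp [h0]
  · refine ENNReal.mul_ne_top ENNReal.ofReal_ne_top fun h' => hcfin i ?_
    rw [h', ENNReal.mul_top h0]

/-- The **Laplace functional** of a Poisson process. -/
theorem IsPoissonProcess.lintegral_exp_neg [IsProbabilityMeasure Pr]
    (h : IsPoissonProcess Pr Z ν) {F : S → ℝ≥0∞} (hF : Measurable F)
    (hfin : ∫⁻ z, F z ∂ν ≠ ∞) :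
    ∫⁻ ω, ENNReal.ofReal (Real.exp (-(∑' k, F (Z k ω)).toReal)) ∂Pr =
      ENNReal.ofReal (Real.exp
        (-(∫⁻ z, ENNReal.ofReal (1 - Real.exp (-(F z).toReal)) ∂ν).toReal)) := by
  let G : ℕ → SimpleFunc S ℝ≥0∞ := SimpleFunc.eapprox F
  have hGle : ∀ n z, G n z ≤ F z := fun n z => by
    rw [← SimpleFunc.iSup_eapprox_apply hF]
    exact le_iSup (fun n => G n z) n
  have hGlim : ∀ z, Filter.Tendsto (fun n => G n z) Filter.atTop (nhds (F z)) := fun z => by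
    rw [← SimpleFunc.iSup_eapprox_apply hF]
    exact tendsto_atTop_iSup fun i j hij => SimpleFunc.monotone_eapprox F hij z
  have hle1 : ∀ x : ℝ≥0∞, ENNReal.ofReal (1 - Real.exp (-x.toReal)) ≤ x := by
    intro x
    refine (ENNReal.ofReal_le_ofReal ?_).trans ENNReal.ofReal_toReal_le
    linarith [Real.add_one_le_exp (-x.toReal)]
  have hGfin : ∀ n, ∫⁻ z, G n z ∂ν ≠ ∞ := fun n =>
    ((lintegral_mono (hGle n)).trans_lt hfin.lt_top).ne
  refine tendsto_nhds_unique (f := fun n => ∫⁻ ω, ENNReal.ofReal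
    (Real.exp (-(∑' k, G n (Z k ω)).toReal)) ∂Pr) (l := Filter.atTop) ?_ ?_
  · refine tendsto_lintegral_of_dominated_convergence (fun _ => 1) (fun n => ?_) (fun n => ?_)
      (by simp) ?_
    · exact (Real.measurable_exp.comp
        (h.measurable_tsum (G n).measurable).ennreal_toReal.neg).ennreal_ofReal
    · refine Filter.Eventually.of_forall fun ω => ?_
      simp
    · filter_upwards [h.ae_tsum_lt_top hF hfin] with ω hω
      have hlim : Filter.Tendsto (fun n => ∑' k, G n (Z k ω)) Filter.atTop
          (nhds (∑' k, F (Z k ω))) := by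
        simp_rw [fun n => (lintegral_countingMeasure Z ω (G n).measurable).symm]
        rw [← lintegral_countingMeasure Z ω hF]
        exact lintegral_tendsto_of_tendsto_of_monotone (fun n => (G n).measurable.aemeasurable)
          (.of_forall fun z i j hij => SimpleFunc.monotone_eapprox F hij z) (.of_forall hGlim)
      refine (ENNReal.continuous_ofReal.tendsto _).comp ((Real.continuous_exp.tendsto _).comp ?_)
      exact ((ENNReal.tendsto_toReal hω.ne).comp hlim).neg
  · simp_rw [fun n => h.lintegral_exp_neg_simpleFunc (G n) (hGfin n)]
    refine (ENNReal.continuous_ofReal.tendsto _).comp ((Real.continuous_exp.tendsto _).comp ?_)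
    refine Filter.Tendsto.neg ((ENNReal.tendsto_toReal ?_).comp ?_)
    · exact ((lintegral_mono fun z => hle1 (F z)).trans_lt hfin.lt_top).ne
    · refine tendsto_lintegral_of_dominated_convergence F (fun n => ?_) (fun n => ?_) hfin ?_
      · exact (Measurable.const_sub (Real.measurable_exp.comp (G n).measurable.ennreal_toReal.neg)
          1).ennreal_ofReal
      · exact .of_forall fun z => (hle1 _).trans (hGle n z)
      · filter_upwards [ae_lt_top hF hfin] with z hz
        refine (ENNReal.continuous_ofReal.tendsto _).comp ?_
        refine Filter.Tendsto.const_sub 1 ((Real.continuous_exp.tendsto _).comp ?_)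
        exact ((ENNReal.tendsto_toReal hz.ne).comp (hGlim z)).neg

end

/-! ### The Laplace exponent -/

section
variable {M : ℝ} {ρ : Measure ℝ}

theorem laplaceExponentTilde_eq (hM : M ≠ 0) (v : ℝ) :
    laplaceExponentTilde M ρ v = ∫ t in Ioi (0 : ℝ), (1 - Real.exp (-(t * v))) ∂ρ := by
  rw [laplaceExponentTilde, laplaceExponent, mul_div_cancel_left₀ _ hM]

theorem abs_exp_neg_sub_exp_neg_le {x y : ℝ} (hx : 0 ≤ x) (hy : 0 ≤ y) :
    |Real.exp (-x) - Real.exp (-y)| ≤ |x - y| := by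
  wlog hxy : x ≤ y generalizing x y
  · rw [abs_sub_comm, abs_sub_comm x y]
    exact this hy hx (le_of_not_ge hxy)
  have h1 : Real.exp (-y) ≤ Real.exp (-x) := Real.exp_le_exp.2 (by linarith)
  rw [abs_of_nonneg (by linarith), abs_of_nonpos (by linarith)]
  have h2 := Real.add_one_le_exp (-(y - x))
  have h3 : Real.exp (-y) = Real.exp (-x) * Real.exp (-(y - x)) := by
    rw [← Real.exp_add]; ring_nf
  have h4 : Real.exp (-x) ≤ 1 := Real.exp_le_one_iff.2 (by linarith)
  nlinarith [Real.exp_pos (-x)]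

theorem integrableOn_one_sub_exp (hρ : IntegrableOn (fun t : ℝ => t) (Ioi 0) ρ) {v : ℝ}
    (hv : 0 ≤ v) : IntegrableOn (fun t : ℝ => 1 - Real.exp (-(t * v))) (Ioi 0) ρ := by
  refine Integrable.mono' (hρ.mul_const v) (by fun_prop) ?_
  filter_upwards [ae_restrict_mem measurableSet_Ioi] with t ht
  have := abs_exp_neg_sub_exp_neg_le le_rfl (mul_nonneg (le_of_lt ht) hv)
  simpa [abs_of_nonneg (mul_nonneg (le_of_lt ht) hv)] using this

theorem laplaceExponentTilde_zero : laplaceExponentTilde M ρ 0 = 0 := by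
  simp [laplaceExponentTilde, laplaceExponent]

theorem laplaceExponentTilde_nonneg (hM : M ≠ 0) {v : ℝ} (hv : 0 ≤ v) :
    0 ≤ laplaceExponentTilde M ρ v := by
  rw [laplaceExponentTilde_eq hM]
  refine setIntegral_nonneg measurableSet_Ioi fun t ht => ?_
  have := Real.exp_le_one_iff.2 (neg_nonpos.2 (mul_nonneg (le_of_lt ht) hv))
  linarith

theorem abs_laplaceExponentTilde_sub_le (hM : M ≠ 0)
    (hρ : IntegrableOn (fun t : ℝ => t) (Ioi 0) ρ) {u v : ℝ} (hu : 0 ≤ u) (hv : 0 ≤ v) :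
    |laplaceExponentTilde M ρ u - laplaceExponentTilde M ρ v| ≤
      (∫ t in Ioi (0 : ℝ), t ∂ρ) * |u - v| := by
  rw [laplaceExponentTilde_eq hM, laplaceExponentTilde_eq hM,
    ← integral_sub (integrableOn_one_sub_exp hρ hu) (integrableOn_one_sub_exp hρ hv),
    ← integral_mul_const, ← Real.norm_eq_abs]
  refine norm_integral_le_of_norm_le (hρ.mul_const _) ?_
  filter_upwards [ae_restrict_mem measurableSet_Ioi] with t ht
  have ht' : 0 ≤ t := le_of_lt ht
  have := abs_exp_neg_sub_exp_neg_le (mul_nonneg ht' hv) (mul_nonneg ht' hu)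
  rw [Real.norm_eq_abs]
  calc |1 - Real.exp (-(t * u)) - (1 - Real.exp (-(t * v)))|
      = |Real.exp (-(t * v)) - Real.exp (-(t * u))| := by congr 1; ring
    _ ≤ |t * v - t * u| := this
    _ = t * |u - v| := by rw [← mul_sub, abs_mul, abs_of_nonneg ht', abs_sub_comm]

theorem continuousOn_laplaceExponentTilde (hM : M ≠ 0)
    (hρ : IntegrableOn (fun t : ℝ => t) (Ioi 0) ρ) :
    ContinuousOn (laplaceExponentTilde M ρ) (Ici 0) := by
  refine (LipschitzOnWith.of_dist_le_mul (K := ⟨∫ t in Ioi (0 : ℝ), t ∂ρ, ?_⟩)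
    fun u hu v hv => ?_).continuousOn
  · exact setIntegral_nonneg measurableSet_Ioi fun t ht => le_of_lt ht
  · exact abs_laplaceExponentTilde_sub_le hM hρ hu hv

theorem hasDerivAt_laplaceExponentTilde (hM : M ≠ 0)
    (hρ : IntegrableOn (fun t : ℝ => t) (Ioi 0) ρ) {v : ℝ} (hv : 0 < v) :
    IntegrableOn (fun t : ℝ => t * Real.exp (-(t * v))) (Ioi 0) ρ ∧
    HasDerivAt (laplaceExponentTilde M ρ)
      (∫ t in Ioi (0 : ℝ), t * Real.exp (-(t * v)) ∂ρ) v := by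
  rw [funext (laplaceExponentTilde_eq (ρ := ρ) hM)]
  refine hasDerivAt_integral_of_dominated_loc_of_deriv_le
    (F := fun v t => 1 - Real.exp (-(t * v))) (F' := fun v t => t * Real.exp (-(t * v)))
    (bound := fun t => t) (Ioi_mem_nhds hv) (.of_forall fun u => by fun_prop)
    (integrableOn_one_sub_exp hρ hv.le) (by fun_prop) ?_ hρ ?_
  · filter_upwards [ae_restrict_mem measurableSet_Ioi] with t ht u hu
    have ht' : 0 ≤ t := le_of_lt ht
    have hu' : 0 ≤ u := le_of_lt hu
    rw [Real.norm_of_nonneg (by positivity)]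
    exact mul_le_of_le_one_right ht'
      (Real.exp_le_one_iff.2 (neg_nonpos.2 (mul_nonneg ht' hu')))
  · refine .of_forall fun t u _ => ?_
    have := (((hasDerivAt_id u).const_mul t).neg.exp).const_sub 1
    simpa [mul_comm] using this

theorem deriv_laplaceExponentTilde_nonneg (hM : M ≠ 0)
    (hρ : IntegrableOn (fun t : ℝ => t) (Ioi 0) ρ) {v : ℝ} (hv : 0 < v) :
    0 ≤ deriv (laplaceExponentTilde M ρ) v := by
  rw [(hasDerivAt_laplaceExponentTilde hM hρ hv).2.deriv]
  refine setIntegral_nonneg measurableSet_Ioi fun t ht => ?_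
  exact mul_nonneg (le_of_lt ht) (Real.exp_pos _).le

/-- The chord inequality `v ψ̃'(v) ≤ ψ̃(v)` of the concave function `ψ̃` with `ψ̃(0) = 0`. -/
theorem mul_deriv_laplaceExponentTilde_le (hM : M ≠ 0)
    (hρ : IntegrableOn (fun t : ℝ => t) (Ioi 0) ρ) {v : ℝ} (hv : 0 < v) :
    v * deriv (laplaceExponentTilde M ρ) v ≤ laplaceExponentTilde M ρ v := by
  obtain ⟨h1, h2⟩ := hasDerivAt_laplaceExponentTilde hM hρ hv
  rw [h2.deriv, laplaceExponentTilde_eq hM, ← integral_const_mul]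
  refine setIntegral_mono (h1.const_mul v) (integrableOn_one_sub_exp hρ hv.le) fun t => ?_
  have h3 := Real.add_one_le_exp (t * v)
  have h4 : Real.exp (-(t * v)) * Real.exp (t * v) = 1 := by rw [← Real.exp_add]; simp
  simp only
  nlinarith [Real.exp_pos (-(t * v))]

/-- `v ψ̃'(v)² e^{-Mψ̃(v)}` is integrable: by the chord inequality it is at most
`ψ̃ ψ̃' e^{-Mψ̃} ≤ (2/M) ψ̃' e^{-Mψ̃/2}`, and the last function is the derivative of a bounded
monotone function. -/
theorem integrableOn_mul_deriv_sq_mul_exp (hM : 0 < M)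
    (hρ : IntegrableOn (fun t : ℝ => t) (Ioi 0) ρ) :
    IntegrableOn (fun v : ℝ => v * (deriv (laplaceExponentTilde M ρ) v ^ 2 *
      Real.exp (-(M * laplaceExponentTilde M ρ v)))) (Ioi 0) := by
  set ψ := laplaceExponentTilde M ρ with hψ
  let g : ℝ → ℝ := fun v => -((4 / M ^ 2) * Real.exp (-(M / 2 * ψ v)))
  have hderiv : ∀ v ∈ Ioi (0 : ℝ),
      HasDerivAt g (2 / M * (deriv ψ v * Real.exp (-(M / 2 * ψ v)))) v := by
    intro v hv
    have h1 := (hasDerivAt_laplaceExponentTilde hM.ne' hρ hv).2.differentiableAt.hasDerivAt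
    have h2 := ((h1.const_mul (M / 2)).neg.exp.const_mul (4 / M ^ 2)).neg
    refine h2.congr_deriv ?_
    simp only [Pi.neg_apply]
    field_simp
    ring
  have hpos : ∀ v ∈ Ioi (0 : ℝ), 0 ≤ 2 / M * (deriv ψ v * Real.exp (-(M / 2 * ψ v))) := by
    intro v hv
    have := deriv_laplaceExponentTilde_nonneg hM.ne' hρ hv
    positivity
  have hcont : ContinuousOn g (Ici 0) := by
    have := continuousOn_laplaceExponentTilde hM.ne' hρ
    fun_prop
  have hmono : MonotoneOn g (Ici 0) := by
    refine monotoneOn_of_deriv_nonneg (convex_Ici 0) hcont ?_ ?_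
    · rw [interior_Ici]
      exact fun v hv => (hderiv v hv).differentiableAt.differentiableWithinAt
    · rw [interior_Ici]
      exact fun v hv => by rw [(hderiv v hv).deriv]; exact hpos v hv
  have hmono' : Monotone fun v => g (max v 0) := fun u v huv =>
    hmono (mem_Ici.2 (le_max_right _ _)) (mem_Ici.2 (le_max_right _ _)) (max_le_max_right 0 huv)
  have hbdd : BddAbove (range fun v => g (max v 0)) := by
    refine ⟨0, ?_⟩
    rintro _ ⟨v, rfl⟩
    exact neg_nonpos.2 (by positivity)
  have hlim : Filter.Tendsto g Filter.atTop (nhds (⨆ v, g (max v 0))) := by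
    refine (tendsto_atTop_ciSup hmono' hbdd).congr' ?_
    filter_upwards [Filter.eventually_ge_atTop 0] with v hv
    rw [max_eq_left hv]
  have hint := integrableOn_Ioi_deriv_of_nonneg (hcont 0 self_mem_Ici) hderiv hpos hlim
  have hψm : AEStronglyMeasurable ψ (volume.restrict (Ioi 0)) :=
    ((continuousOn_laplaceExponentTilde hM.ne' hρ).mono Ioi_subset_Ici_self).aestronglyMeasurable
      measurableSet_Ioi
  have hψ'm : AEStronglyMeasurable (deriv ψ) (volume.restrict (Ioi 0)) :=
    (measurable_deriv ψ).aestronglyMeasurable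
  refine Integrable.mono' hint ?_ ?_
  · exact aestronglyMeasurable_id.mul ((hψ'm.pow 2).mul
      (Real.continuous_exp.comp_aestronglyMeasurable (hψm.const_mul M).neg))
  · filter_upwards [ae_restrict_mem measurableSet_Ioi] with v hv
    have h0 : 0 < v := hv
    have h1 := deriv_laplaceExponentTilde_nonneg hM.ne' hρ hv
    have h2 := mul_deriv_laplaceExponentTilde_le hM.ne' hρ hv
    rw [← hψ] at h1 h2
    have h3 := Real.add_one_le_exp (M / 2 * ψ v)
    set E := Real.exp (-(M / 2 * ψ v)) with hE
    have hEpos : 0 < E := Real.exp_pos _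
    have h4 : E * Real.exp (M / 2 * ψ v) = 1 := by rw [hE, ← Real.exp_add]; simp
    have h5 : Real.exp (-(M * ψ v)) = E * E := by rw [hE, ← Real.exp_add]; ring_nf
    have h6 : ψ v * E ≤ 2 / M := by
      rw [le_div_iff₀ hM]
      nlinarith
    rw [Real.norm_of_nonneg (by positivity), h5]
    calc v * (deriv ψ v ^ 2 * (E * E)) = (v * deriv ψ v) * E * (deriv ψ v * E) := by ring
      _ ≤ ψ v * E * (deriv ψ v * E) := by gcongr
      _ ≤ 2 / M * (deriv ψ v * E) := by gcongr

end

section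
open Filter
open scoped Topology

/-! ### Weighted sums of the points of the random measure -/

/-- The weighted sum `∑ₖ Jₖ f(θₖ) = ∫ f dμ̃` of a nonnegative function `f`, as a real number. -/
noncomputable def weightedSum {Ω X : Type*} (J : ℕ → Ω → ℝ) (θ : ℕ → Ω → X) (f : X → ℝ) (ω : Ω) :
    ℝ :=
  (∑' k, ENNReal.ofReal (J k ω) * ENNReal.ofReal (f (θ k ω))).toReal

section
variable {Ω X : Type*} {J : ℕ → Ω → ℝ} {θ : ℕ → Ω → X}

theorem weightedSum_nonneg (f : X → ℝ) (ω : Ω) : 0 ≤ weightedSum J θ f ω :=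
  ENNReal.toReal_nonneg

theorem weightedSum_const_add_add {f g : X → ℝ} {v a b : ℝ} (hv : 0 ≤ v) (ha : 0 ≤ a) (hb : 0 ≤ b)
    (hf : ∀ x, f x ∈ Icc 0 1) (hg : ∀ x, g x ∈ Icc 0 1) {ω : Ω}
    (hω : ∑' k, ENNReal.ofReal (J k ω) ≠ ∞) :
    weightedSum J θ (fun x => v + a * f x + b * g x) ω =
      v * weightedSum J θ (fun _ => 1) ω + a * weightedSum J θ f ω +
        b * weightedSum J θ g ω := by
  have hfin : ∀ h : X → ℝ, (∀ x, h x ∈ Icc 0 1) →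
      ∑' k, ENNReal.ofReal (J k ω) * ENNReal.ofReal (h (θ k ω)) ≠ ∞ := by
    intro h hh
    refine ne_top_of_le_ne_top hω (ENNReal.tsum_le_tsum fun k => mul_le_of_le_one_right' ?_)
    exact ENNReal.ofReal_le_one.2 (hh _).2
  have h1 : ∀ k, ENNReal.ofReal (J k ω) *
      ENNReal.ofReal (v + a * f (θ k ω) + b * g (θ k ω)) =
      ENNReal.ofReal v * (ENNReal.ofReal (J k ω) * ENNReal.ofReal 1) +
      ENNReal.ofReal a * (ENNReal.ofReal (J k ω) * ENNReal.ofReal (f (θ k ω))) +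
      ENNReal.ofReal b * (ENNReal.ofReal (J k ω) * ENNReal.ofReal (g (θ k ω))) := by
    intro k
    have h2 := mul_nonneg ha (hf (θ k ω)).1
    have h3 := mul_nonneg hb (hg (θ k ω)).1
    rw [ENNReal.ofReal_add (by positivity) h3, ENNReal.ofReal_add hv h2, ENNReal.ofReal_mul ha,
      ENNReal.ofReal_mul hb, ENNReal.ofReal_one]
    ring
  simp only [weightedSum]
  have hone := hfin (fun _ => 1) fun _ => by simp
  have hf' := ENNReal.mul_ne_top (ENNReal.ofReal_ne_top (r := a)) (hfin f hf)
  have hg' := ENNReal.mul_ne_top (ENNReal.ofReal_ne_top (r := b)) (hfin g hg)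
  have hv' := ENNReal.mul_ne_top (ENNReal.ofReal_ne_top (r := v)) hone
  rw [tsum_congr h1, ENNReal.tsum_add, ENNReal.tsum_add, ENNReal.tsum_mul_left,
    ENNReal.tsum_mul_left, ENNReal.tsum_mul_left, ENNReal.toReal_add (ENNReal.add_ne_top.2
      ⟨hv', hf'⟩) hg', ENNReal.toReal_add hv' hf', ENNReal.toReal_mul, ENNReal.toReal_mul,
    ENNReal.toReal_mul, ENNReal.toReal_ofReal hv, ENNReal.toReal_ofReal ha,
    ENNReal.toReal_ofReal hb]

theorem weightedSum_le {f : X → ℝ} (hf : ∀ x, f x ≤ 1) {ω : Ω}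
    (hω : ∑' k, ENNReal.ofReal (J k ω) ≠ ∞) :
    weightedSum J θ f ω ≤ weightedSum J θ (fun _ => 1) ω := by
  refine ENNReal.toReal_mono (by simpa using hω) (ENNReal.tsum_le_tsum fun k => ?_)
  gcongr
  exact hf _

end

/-- A measure with a finite first moment on `(0, ∞)` is s-finite there: it has density `1 / t`
with respect to the finite measure `t ρ(dt)`. -/
theorem sFinite_restrict_Ioi {ρ : Measure ℝ} (hρ : IntegrableOn (fun t : ℝ => t) (Ioi 0) ρ) :
    SFinite (ρ.restrict (Ioi 0)) := by
  have hfin : ∫⁻ t in Ioi (0 : ℝ), ENNReal.ofReal t ∂ρ ≠ ∞ := hρ.lintegral_lt_top.ne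
  have := isFiniteMeasure_withDensity hfin
  rw [← withDensity_inv_same (μ := ρ.restrict (Ioi 0)) ENNReal.measurable_ofReal ?_ ?_]
  · infer_instance
  · filter_upwards [ae_restrict_mem measurableSet_Ioi] with t ht
    exact (ENNReal.ofReal_pos.2 ht).ne'
  · exact .of_forall fun t => ENNReal.ofReal_ne_top

theorem measurable_laplaceExponentTilde {M : ℝ} {ρ : Measure ℝ}
    (hρ : IntegrableOn (fun t : ℝ => t) (Ioi 0) ρ) : Measurable (laplaceExponentTilde M ρ) := by
  have := sFinite_restrict_Ioi hρ
  have h : Measurable fun z : ℝ × ℝ => 1 - Real.exp (-(z.2 * z.1)) := by fun_prop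
  exact (h.stronglyMeasurable.integral_prod_right.measurable.const_mul M).div_const M

section
variable {Ω X : Type*} [MeasurableSpace Ω] [MeasurableSpace X] {Pr : Measure Ω}
  {P : Measure X} {M : ℝ} {ρ : Measure ℝ} {J : ℕ → Ω → ℝ} {θ : ℕ → Ω → X}

theorem lintegral_levyMeasure [SFinite P] (hρ : IntegrableOn (fun t : ℝ => t) (Ioi 0) ρ)
    {F : ℝ × X → ℝ≥0∞} (hF : Measurable F) :
    ∫⁻ z, F z ∂(levyMeasure M ρ P) =
      ENNReal.ofReal M * ∫⁻ x, ∫⁻ t in Ioi (0 : ℝ), F (t, x) ∂ρ ∂P := by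
  have := sFinite_restrict_Ioi hρ
  rw [levyMeasure, lintegral_smul_measure, lintegral_prod_symm _ hF.aemeasurable, smul_eq_mul]

theorem measurable_weight {w : X → ℝ} (hw : Measurable w) :
    Measurable fun z : ℝ × X => ENNReal.ofReal z.1 * ENNReal.ofReal (w z.2) :=
  measurable_fst.ennreal_ofReal.mul (hw.comp measurable_snd).ennreal_ofReal

theorem lintegral_levyMeasure_weight_ne_top [IsFiniteMeasure P]
    (hρ : IntegrableOn (fun t : ℝ => t) (Ioi 0) ρ) {w : X → ℝ} (hw : Measurable w) {K : ℝ}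
    (hK : ∀ x, w x ≤ K) :
    ∫⁻ z : ℝ × X, ENNReal.ofReal z.1 * ENNReal.ofReal (w z.2) ∂(levyMeasure M ρ P) ≠ ∞ := by
  rw [lintegral_levyMeasure hρ (measurable_weight hw)]
  refine ENNReal.mul_ne_top ENNReal.ofReal_ne_top (ne_of_lt ?_)
  calc ∫⁻ x, ∫⁻ t in Ioi (0 : ℝ), ENNReal.ofReal t * ENNReal.ofReal (w x) ∂ρ ∂P
      ≤ ∫⁻ _, ∫⁻ t in Ioi (0 : ℝ), ENNReal.ofReal t * ENNReal.ofReal K ∂ρ ∂P := by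
        gcongr with x t
        exact hK x
    _ < ∞ := by
        rw [lintegral_const, lintegral_mul_const _ ENNReal.measurable_ofReal]
        exact ENNReal.mul_lt_top
          (ENNReal.mul_lt_top hρ.lintegral_lt_top ENNReal.ofReal_lt_top) (measure_lt_top _ _)

theorem IsPoissonProcess.ae_weight_lt_top [IsProbabilityMeasure Pr] [IsFiniteMeasure P]
    (hN : IsPoissonProcess Pr (fun k ω => (J k ω, θ k ω)) (levyMeasure M ρ P))
    (hρ : IntegrableOn (fun t : ℝ => t) (Ioi 0) ρ) {w : X → ℝ} (hw : Measurable w) {K : ℝ}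
    (hK : ∀ x, w x ≤ K) :
    ∀ᵐ ω ∂Pr, ∑' k, ENNReal.ofReal (J k ω) * ENNReal.ofReal (w (θ k ω)) < ∞ :=
  hN.ae_tsum_lt_top (measurable_weight hw) (lintegral_levyMeasure_weight_ne_top hρ hw hK)

theorem IsPoissonProcess.measurable_weightedSum {ν : Measure (ℝ × X)}
    (hN : IsPoissonProcess Pr (fun k ω => (J k ω, θ k ω)) ν)
    {w : X → ℝ} (hw : Measurable w) : Measurable (weightedSum J θ w) :=
  (hN.measurable_tsum (measurable_weight hw)).ennreal_toReal

/-- The Laplace functional of `μ̃`, in terms of the Laplace exponent. -/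
theorem integral_exp_neg_weightedSum [IsProbabilityMeasure Pr] [IsFiniteMeasure P] (hM : 0 < M)
    (hρ : IntegrableOn (fun t : ℝ => t) (Ioi 0) ρ)
    (hN : IsPoissonProcess Pr (fun k ω => (J k ω, θ k ω)) (levyMeasure M ρ P))
    {w : X → ℝ} (hw : Measurable w) (h0 : ∀ x, 0 ≤ w x) {K : ℝ} (hK : ∀ x, w x ≤ K) :
    ∫ ω, Real.exp (-(weightedSum J θ w ω)) ∂Pr =
      Real.exp (-(M * ∫ x, laplaceExponentTilde M ρ (w x) ∂P)) := by
  have hψm := (measurable_laplaceExponentTilde (M := M) hρ).comp hw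
  have h1 := hN.lintegral_exp_neg (measurable_weight hw)
    (lintegral_levyMeasure_weight_ne_top hρ hw hK)
  rw [integral_eq_lintegral_of_nonneg_ae (.of_forall fun ω => (Real.exp_pos _).le)
    (show Measurable fun ω => Real.exp (-(weightedSum J θ w ω)) from
      Real.measurable_exp.comp (hN.measurable_weightedSum hw).neg).aestronglyMeasurable]
  simp only [weightedSum]
  rw [h1, ENNReal.toReal_ofReal (Real.exp_pos _).le, lintegral_levyMeasure hρ]
  · congr 2
    rw [ENNReal.toReal_mul, ENNReal.toReal_ofReal hM.le]
    congr 1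
    rw [integral_eq_lintegral_of_nonneg_ae
      (.of_forall fun x => laplaceExponentTilde_nonneg hM.ne' (h0 x)) hψm.aestronglyMeasurable]
    congr 1
    refine lintegral_congr fun x => ?_
    rw [laplaceExponentTilde_eq hM.ne', ofReal_integral_eq_lintegral_ofReal
      (integrableOn_one_sub_exp hρ (h0 x))]
    · refine setLIntegral_congr_fun measurableSet_Ioi fun t ht => ?_
      simp only [ENNReal.toReal_mul, ENNReal.toReal_ofReal (le_of_lt ht),
        ENNReal.toReal_ofReal (h0 x)]
    · filter_upwards [ae_restrict_mem measurableSet_Ioi] with t ht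
      have := Real.exp_le_one_iff.2 (neg_nonpos.2 (mul_nonneg (le_of_lt ht) (h0 x)))
      simpa using this
  · exact (Measurable.const_sub (Real.measurable_exp.comp
      (measurable_weight hw).ennreal_toReal.neg) 1).ennreal_ofReal

/-- Almost surely `0 < μ̃(X) < ∞`: the mean measure does not charge `(-∞, 0] × X`, so the jumps are
positive, and `μ̃(X)` has a finite mean. -/
theorem IsPoissonProcess.ae_tsum_ofReal_mem_Ioo [IsProbabilityMeasure Pr] [IsProbabilityMeasure P]
    (hN : IsPoissonProcess Pr (fun k ω => (J k ω, θ k ω)) (levyMeasure M ρ P))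
    (hρ : IntegrableOn (fun t : ℝ => t) (Ioi 0) ρ) :
    ∀ᵐ ω ∂Pr, ∑' k, ENNReal.ofReal (J k ω) ∈ Ioo 0 ∞ := by
  have hpos : ∀ᵐ ω ∂Pr, 0 < J 0 ω := by
    have := sFinite_restrict_Ioi hρ
    have hS : MeasurableSet (Iic (0 : ℝ) ×ˢ (univ : Set X)) := measurableSet_Iic.prod .univ
    have h0 : levyMeasure M ρ P (Iic (0 : ℝ) ×ˢ (univ : Set X)) = 0 := by
      simp [levyMeasure, Measure.prod_prod, Measure.restrict_apply measurableSet_Iic,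
        Iic_inter_Ioi]
    rw [← hN.sum_map_eq, Measure.sum_apply _ hS, ENNReal.tsum_eq_zero] at h0
    have h1 := h0 0
    rw [Measure.map_apply (hN.measurable 0) hS] at h1
    filter_upwards [measure_eq_zero_iff_ae_notMem.1 h1] with ω hω
    simpa using hω
  filter_upwards [hpos, hN.ae_weight_lt_top hρ (w := fun _ => 1) measurable_const fun _ => le_rfl]
    with ω h1 h2
  refine ⟨(ENNReal.ofReal_pos.2 h1).trans_le (ENNReal.le_tsum 0), by simpa using h2⟩

end

/-! ### Moments of weighted sums under exponential tilting -/

theorem tendsto_inv_mul_one_sub_exp_neg (x : ℝ) :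
    Tendsto (fun a : ℝ => a⁻¹ * (1 - Real.exp (-(a * x)))) (𝓝[>] 0) (𝓝 x) := by
  have h : HasDerivAt (fun a : ℝ => 1 - Real.exp (-(a * x))) x 0 := by
    simpa using (((hasDerivAt_id (0 : ℝ)).mul_const x).neg.exp).const_sub 1
  simpa using h.tendsto_slope_zero_right

theorem inv_mul_one_sub_exp_neg_mem_Icc {a x : ℝ} (ha : 0 < a) (hx : 0 ≤ x) :
    a⁻¹ * (1 - Real.exp (-(a * x))) ∈ Icc 0 x := by
  have h1 : Real.exp (-(a * x)) ≤ 1 := Real.exp_le_one_iff.2 (by nlinarith)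
  refine ⟨mul_nonneg (inv_nonneg.2 ha.le) (by linarith), ?_⟩
  rw [inv_mul_le_iff₀ ha]
  linarith [Real.add_one_le_exp (-(a * x))]

theorem mul_exp_neg_mul_le {v s : ℝ} (hv : 0 < v) :
    s * Real.exp (-(v * s)) ≤ 1 / v := by
  rw [le_div_iff₀ hv]
  have h1 := Real.add_one_le_exp (v * s)
  have h2 : Real.exp (-(v * s)) * Real.exp (v * s) = 1 := by rw [← Real.exp_add]; simp
  nlinarith [Real.exp_pos (-(v * s))]

theorem sq_mul_exp_neg_mul_le {v s : ℝ} (hv : 0 < v) (hs : 0 ≤ s) :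
    s ^ 2 * Real.exp (-(v * s)) ≤ 2 / v ^ 2 := by
  rw [le_div_iff₀ (by positivity)]
  have h1 := Real.quadratic_le_exp_of_nonneg (mul_nonneg hv.le hs)
  have h2 : Real.exp (-(v * s)) * Real.exp (v * s) = 1 := by rw [← Real.exp_add]; simp
  have h3 : (v * s) ^ 2 ≤ 2 * Real.exp (v * s) := by nlinarith [mul_nonneg hv.le hs]
  nlinarith [Real.exp_pos (-(v * s))]

section
variable {Ω X : Type*} [MeasurableSpace Ω] [MeasurableSpace X] {Pr : Measure Ω}
  {P : Measure X} {M : ℝ} {ρ : Measure ℝ} {J : ℕ → Ω → ℝ} {θ : ℕ → Ω → X}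

theorem hasDerivAt_integral_laplaceExponentTilde [IsFiniteMeasure P] (hM : 0 < M)
    (hρ : IntegrableOn (fun t : ℝ => t) (Ioi 0) ρ) {v : ℝ} (hv : 0 < v)
    {f : X → ℝ} (hfm : Measurable f) (hf : ∀ x, f x ∈ Icc 0 1) :
    HasDerivAt (fun a : ℝ => ∫ x, laplaceExponentTilde M ρ (v + a * f x) ∂P)
      (deriv (laplaceExponentTilde M ρ) v * ∫ x, f x ∂P) 0 := by
  set ψ := laplaceExponentTilde M ρ with hψ
  have hψm : Measurable ψ := measurable_laplaceExponentTilde hρ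
  have hm0 : 0 ≤ ∫ t in Ioi (0 : ℝ), t ∂ρ :=
    setIntegral_nonneg measurableSet_Ioi fun t ht => le_of_lt ht
  rw [← integral_const_mul]
  refine (hasDerivAt_integral_of_dominated_loc_of_lip
    (F := fun a x => ψ (v + a * f x)) (bound := fun _ => ∫ t in Ioi (0 : ℝ), t ∂ρ)
    (Ioo_mem_nhds (neg_lt_zero.2 hv) hv) (.of_forall fun a => ?_) (by simp) ?_
    (.of_forall fun x => ?_) (integrable_const _) (.of_forall fun x => ?_)).2
  · exact (hψm.comp ((hfm.const_mul a).const_add v)).aestronglyMeasurable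
  · exact (hfm.const_mul _).aestronglyMeasurable
  · obtain ⟨h0, h1⟩ := hf x
    have hnn : ∀ a ∈ Ioo (-v) v, 0 ≤ v + a * f x := fun a ha => by nlinarith [ha.1, ha.2]
    refine LipschitzOnWith.of_dist_le_mul fun a ha b hb => ?_
    rw [Real.coe_nnabs, abs_of_nonneg hm0, Real.dist_eq, Real.dist_eq]
    refine (abs_laplaceExponentTilde_sub_le hM.ne' hρ (hnn a ha) (hnn b hb)).trans ?_
    refine mul_le_mul_of_nonneg_left ?_ hm0
    rw [show v + a * f x - (v + b * f x) = (a - b) * f x by ring, abs_mul, abs_of_nonneg h0]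
    exact mul_le_of_le_one_right (abs_nonneg _) h1
  · have h1 := (hasDerivAt_laplaceExponentTilde hM.ne' hρ hv).2.differentiableAt.hasDerivAt
    have h2 : HasDerivAt (fun a : ℝ => v + a * f x) (f x) 0 := by
      simpa using ((hasDerivAt_id (0 : ℝ)).mul_const (f x)).const_add v
    have h3 : HasDerivAt ψ (deriv ψ v) (v + 0 * f x) := by simpa using h1
    exact h3.comp 0 h2

/-- The one-sided derivative at `a = 0` of the Laplace functional at the weight `v + a f`, with the
sign reversed. -/
theorem tendsto_slope_exp_neg_integral [IsProbabilityMeasure P] (hM : 0 < M)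
    (hρ : IntegrableOn (fun t : ℝ => t) (Ioi 0) ρ) {v : ℝ} (hv : 0 < v)
    {f : X → ℝ} (hfm : Measurable f) (hf : ∀ x, f x ∈ Icc 0 1) :
    Tendsto (fun a : ℝ => a⁻¹ * (Real.exp (-(M * laplaceExponentTilde M ρ v)) -
        Real.exp (-(M * ∫ x, laplaceExponentTilde M ρ (v + a * f x) ∂P)))) (𝓝[>] 0)
      (𝓝 (Real.exp (-(M * laplaceExponentTilde M ρ v)) *
        (M * deriv (laplaceExponentTilde M ρ) v * ∫ x, f x ∂P))) := by
  have h := (((hasDerivAt_integral_laplaceExponentTilde (P := P) hM hρ hv hfm hf).const_mul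
    M).neg.exp).tendsto_slope_zero_right.neg
  simp only [Pi.neg_apply, zero_add, zero_mul, add_zero, integral_const, probReal_univ,
    smul_eq_mul, one_mul, mul_neg, neg_neg] at h
  rw [mul_assoc M]
  refine h.congr fun a => ?_
  ring

theorem integrable_laplaceExponentTilde_comp [IsFiniteMeasure P] (hM : 0 < M)
    (hρ : IntegrableOn (fun t : ℝ => t) (Ioi 0) ρ) {v a : ℝ} (hv : 0 ≤ v) (ha : 0 ≤ a)
    {f : X → ℝ} (hfm : Measurable f) (hf : ∀ x, f x ∈ Icc 0 1) :
    Integrable (fun x => laplaceExponentTilde M ρ (v + a * f x)) P := by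
  have hm := (measurable_laplaceExponentTilde (M := M) hρ).comp ((hfm.const_mul a).const_add v)
  refine Integrable.of_bound (C := (∫ t in Ioi (0 : ℝ), t ∂ρ) * (v + a))
    hm.aestronglyMeasurable (.of_forall fun x => ?_)
  have h1 := mul_nonneg ha (hf x).1
  have h2 : a * f x ≤ a := mul_le_of_le_one_right ha (hf x).2
  have h3 := abs_laplaceExponentTilde_sub_le hM.ne' hρ (add_nonneg hv h1) le_rfl
  rw [laplaceExponentTilde_zero, sub_zero, sub_zero, abs_of_nonneg (add_nonneg hv h1)] at h3
  refine h3.trans (mul_le_mul_of_nonneg_left (by linarith) ?_)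
  exact setIntegral_nonneg measurableSet_Ioi fun t ht => le_of_lt ht

/-- Where `f` or `g` vanishes, the increment of `ψ̃` from `v` to `v + a f + a g` is the sum of the
increments for `f` and `g`. -/
theorem integral_laplaceExponentTilde_add_add [IsProbabilityMeasure P] (hM : 0 < M)
    (hρ : IntegrableOn (fun t : ℝ => t) (Ioi 0) ρ) {v a : ℝ} (hv : 0 ≤ v) (ha : 0 ≤ a)
    {f g : X → ℝ} (hfm : Measurable f) (hgm : Measurable g) (hf : ∀ x, f x ∈ Icc 0 1)
    (hg : ∀ x, g x ∈ Icc 0 1) (hfg : ∀ᵐ x ∂P, f x = 0 ∨ g x = 0) :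
    ∫ x, laplaceExponentTilde M ρ (v + a * f x + a * g x) ∂P =
      (∫ x, laplaceExponentTilde M ρ (v + a * f x) ∂P) +
        (∫ x, laplaceExponentTilde M ρ (v + a * g x) ∂P) - laplaceExponentTilde M ρ v := by
  have h1 := integrable_laplaceExponentTilde_comp (P := P) hM hρ hv ha hfm hf
  have h2 := integrable_laplaceExponentTilde_comp (P := P) hM hρ hv ha hgm hg
  have h3 : Integrable (fun x => laplaceExponentTilde M ρ (v + a * f x) +
    laplaceExponentTilde M ρ (v + a * g x)) P := h1.add h2
  have h4 : ∀ᵐ x ∂P, laplaceExponentTilde M ρ (v + a * f x + a * g x) =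
      laplaceExponentTilde M ρ (v + a * f x) + laplaceExponentTilde M ρ (v + a * g x) -
        laplaceExponentTilde M ρ v := by
    filter_upwards [hfg] with x hx
    rcases hx with hx | hx <;> simp [hx]
  rw [integral_congr_ae h4, integral_sub h3 (integrable_const _), integral_add h1 h2]
  simp

theorem integral_exp_neg_add_add [IsProbabilityMeasure Pr] [IsProbabilityMeasure P] (hM : 0 < M)
    (hρ : IntegrableOn (fun t : ℝ => t) (Ioi 0) ρ)
    (hN : IsPoissonProcess Pr (fun k ω => (J k ω, θ k ω)) (levyMeasure M ρ P))
    {v a b : ℝ} (hv : 0 ≤ v) (ha : 0 ≤ a) (hb : 0 ≤ b)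
    {f g : X → ℝ} (hfm : Measurable f) (hgm : Measurable g)
    (hf : ∀ x, f x ∈ Icc 0 1) (hg : ∀ x, g x ∈ Icc 0 1) :
    ∫ ω, Real.exp (-(v * weightedSum J θ (fun _ => 1) ω + a * weightedSum J θ f ω +
        b * weightedSum J θ g ω)) ∂Pr =
      Real.exp (-(M * ∫ x, laplaceExponentTilde M ρ (v + a * f x + b * g x) ∂P)) := by
  rw [← integral_exp_neg_weightedSum (w := fun x => v + a * f x + b * g x) (K := v + a + b)
    hM hρ hN (by fun_prop) (fun x => ?_) (fun x => ?_)]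
  · refine integral_congr_ae ?_
    filter_upwards [hN.ae_tsum_ofReal_mem_Ioo hρ] with ω hω
    rw [weightedSum_const_add_add hv ha hb hf hg hω.2.ne]
  · have := mul_nonneg ha (hf x).1
    have := mul_nonneg hb (hg x).1
    positivity
  · gcongr
    · exact mul_le_of_le_one_right ha (hf x).2
    · exact mul_le_of_le_one_right hb (hg x).2

theorem IsPoissonProcess.integrable_exp_neg_add_add [IsProbabilityMeasure Pr]
    {ν : Measure (ℝ × X)} (hN : IsPoissonProcess Pr (fun k ω => (J k ω, θ k ω)) ν)
    {v a b : ℝ} (hv : 0 ≤ v) (ha : 0 ≤ a) (hb : 0 ≤ b)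
    {f g : X → ℝ} (hfm : Measurable f) (hgm : Measurable g) :
    Integrable (fun ω => Real.exp (-(v * weightedSum J θ (fun _ => 1) ω +
      a * weightedSum J θ f ω + b * weightedSum J θ g ω))) Pr := by
  have h1 := hN.measurable_weightedSum (w := fun _ => 1) measurable_const
  have h2 := hN.measurable_weightedSum hfm
  have h3 := hN.measurable_weightedSum hgm
  refine Integrable.of_bound (by fun_prop) 1 (.of_forall fun ω => ?_)
  have := weightedSum_nonneg (J := J) (θ := θ) (fun _ => 1) ω
  have := weightedSum_nonneg (J := J) (θ := θ) f ω
  have := weightedSum_nonneg (J := J) (θ := θ) g ω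
  rw [Real.norm_of_nonneg (Real.exp_pos _).le, Real.exp_le_one_iff]
  exact neg_nonpos.2 (by positivity)

/-- The first moment under tilting, the derivative of the Laplace functional in the direction `f`:
the difference quotients `(1 - e^{-aU}) / a · e^{-vS}` converge to `U e^{-vS}` and are bounded
by `S e^{-vS} ≤ 1 / v`. -/
theorem integral_weightedSum_mul_exp [IsProbabilityMeasure Pr] [IsProbabilityMeasure P]
    (hM : 0 < M) (hρ : IntegrableOn (fun t : ℝ => t) (Ioi 0) ρ)
    (hN : IsPoissonProcess Pr (fun k ω => (J k ω, θ k ω)) (levyMeasure M ρ P))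
    {v : ℝ} (hv : 0 < v) {f : X → ℝ} (hfm : Measurable f) (hf : ∀ x, f x ∈ Icc 0 1) :
    ∫ ω, weightedSum J θ f ω * Real.exp (-(v * weightedSum J θ (fun _ => 1) ω)) ∂Pr =
      Real.exp (-(M * laplaceExponentTilde M ρ v)) *
        (M * deriv (laplaceExponentTilde M ρ) v * ∫ x, f x ∂P) := by
  have hSm := hN.measurable_weightedSum (w := fun _ => 1) measurable_const
  have hUm := hN.measurable_weightedSum hfm
  refine tendsto_nhds_unique (f := fun a : ℝ => ∫ ω, a⁻¹ *
    (1 - Real.exp (-(a * weightedSum J θ f ω))) *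
      Real.exp (-(v * weightedSum J θ (fun _ => 1) ω)) ∂Pr) (l := 𝓝[>] 0) ?_ ?_
  · refine tendsto_integral_filter_of_dominated_convergence (fun _ => 1 / v)
      (.of_forall fun a => by fun_prop) ?_ (integrable_const _) (.of_forall fun ω => ?_)
    · filter_upwards [self_mem_nhdsWithin] with a ha
      filter_upwards [hN.ae_tsum_ofReal_mem_Ioo hρ] with ω hω
      have h1 := inv_mul_one_sub_exp_neg_mem_Icc ha (weightedSum_nonneg (J := J) (θ := θ) f ω)
      rw [Real.norm_of_nonneg (mul_nonneg h1.1 (Real.exp_pos _).le)]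
      refine le_trans ?_ (mul_exp_neg_mul_le (s := weightedSum J θ (fun _ => 1) ω) hv)
      gcongr
      exact h1.2.trans (weightedSum_le (fun x => (hf x).2) hω.2.ne)
    · exact (tendsto_inv_mul_one_sub_exp_neg _).mul_const _
  · refine (tendsto_slope_exp_neg_integral hM hρ hv hfm hf).congr' ?_
    filter_upwards [self_mem_nhdsWithin] with a ha
    have ha' : 0 ≤ a := le_of_lt ha
    have e0 := integral_exp_neg_add_add hM hρ hN hv.le le_rfl le_rfl hfm hfm hf hf
    have e1 := integral_exp_neg_add_add hM hρ hN hv.le ha' le_rfl hfm hfm hf hf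
    have i0 := hN.integrable_exp_neg_add_add hv.le le_rfl le_rfl hfm hfm
    have i1 := hN.integrable_exp_neg_add_add hv.le ha' le_rfl hfm hfm
    simp only [zero_mul, add_zero, integral_const, probReal_univ, one_smul] at e0 e1 i0 i1
    rw [← e0, ← e1, ← integral_sub i0 i1, ← integral_const_mul]
    refine integral_congr_ae (.of_forall fun ω => ?_)
    simp only
    rw [neg_add, Real.exp_add]
    ring

/-- The mixed second moment under tilting. As `f g = 0` almost everywhere, `f` and `g` weight
independent parts of the process, so the Laplace functional of the weight `v + a f + b g`
factorizes and there is no diagonal term. -/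
theorem integral_weightedSum_mul_weightedSum_mul_exp [IsProbabilityMeasure Pr]
    [IsProbabilityMeasure P]
    (hM : 0 < M) (hρ : IntegrableOn (fun t : ℝ => t) (Ioi 0) ρ)
    (hN : IsPoissonProcess Pr (fun k ω => (J k ω, θ k ω)) (levyMeasure M ρ P))
    {v : ℝ} (hv : 0 < v) {f g : X → ℝ} (hfm : Measurable f) (hgm : Measurable g)
    (hf : ∀ x, f x ∈ Icc 0 1) (hg : ∀ x, g x ∈ Icc 0 1) (hfg : ∀ᵐ x ∂P, f x = 0 ∨ g x = 0) :
    ∫ ω, weightedSum J θ f ω * weightedSum J θ g ω *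
        Real.exp (-(v * weightedSum J θ (fun _ => 1) ω)) ∂Pr =
      Real.exp (-(M * laplaceExponentTilde M ρ v)) *
        (M * deriv (laplaceExponentTilde M ρ) v) ^ 2 * ((∫ x, f x ∂P) * ∫ x, g x ∂P) := by
  have hSm := hN.measurable_weightedSum (w := fun _ => 1) measurable_const
  have hUm := hN.measurable_weightedSum hfm
  have hWm := hN.measurable_weightedSum hgm
  refine tendsto_nhds_unique (f := fun a : ℝ => ∫ ω, a⁻¹ *
    (1 - Real.exp (-(a * weightedSum J θ f ω))) *
    (a⁻¹ * (1 - Real.exp (-(a * weightedSum J θ g ω)))) *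
      Real.exp (-(v * weightedSum J θ (fun _ => 1) ω)) ∂Pr) (l := 𝓝[>] 0) ?_ ?_
  · refine tendsto_integral_filter_of_dominated_convergence (fun _ => 2 / v ^ 2)
      (.of_forall fun a => by fun_prop) ?_ (integrable_const _) (.of_forall fun ω => ?_)
    · filter_upwards [self_mem_nhdsWithin] with a ha
      filter_upwards [hN.ae_tsum_ofReal_mem_Ioo hρ] with ω hω
      have h1 := inv_mul_one_sub_exp_neg_mem_Icc ha (weightedSum_nonneg (J := J) (θ := θ) f ω)
      have h2 := inv_mul_one_sub_exp_neg_mem_Icc ha (weightedSum_nonneg (J := J) (θ := θ) g ω)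
      have hS := weightedSum_nonneg (J := J) (θ := θ) (fun _ => 1) ω
      rw [Real.norm_of_nonneg (mul_nonneg (mul_nonneg h1.1 h2.1) (Real.exp_pos _).le)]
      refine le_trans ?_ (sq_mul_exp_neg_mul_le hv hS)
      rw [sq]
      refine mul_le_mul_of_nonneg_right (mul_le_mul ?_ ?_ h2.1 hS) (Real.exp_pos _).le
      · exact h1.2.trans (weightedSum_le (fun x => (hf x).2) hω.2.ne)
      · exact h2.2.trans (weightedSum_le (fun x => (hg x).2) hω.2.ne)
    · exact ((tendsto_inv_mul_one_sub_exp_neg _).mul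
        (tendsto_inv_mul_one_sub_exp_neg _)).mul_const _
  · have hlim := ((tendsto_slope_exp_neg_integral (P := P) hM hρ hv hfm hf).mul
      (tendsto_slope_exp_neg_integral (P := P) hM hρ hv hgm hg)).div_const
      (Real.exp (-(M * laplaceExponentTilde M ρ v)))
    have hE := (Real.exp_pos (-(M * laplaceExponentTilde M ρ v))).ne'
    refine (hlim.congr' ?_).trans (le_of_eq (congrArg 𝓝 ?_))
    · filter_upwards [self_mem_nhdsWithin] with a ha
      have ha' : 0 ≤ a := le_of_lt ha
      have e0 := integral_exp_neg_add_add hM hρ hN hv.le le_rfl le_rfl hfm hgm hf hg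
      have e1 := integral_exp_neg_add_add hM hρ hN hv.le ha' le_rfl hfm hgm hf hg
      have e2 := integral_exp_neg_add_add hM hρ hN hv.le le_rfl ha' hfm hgm hf hg
      have e3 := integral_exp_neg_add_add hM hρ hN hv.le ha' ha' hfm hgm hf hg
      have i0 := hN.integrable_exp_neg_add_add hv.le le_rfl le_rfl hfm hgm
      have i1 := hN.integrable_exp_neg_add_add hv.le ha' le_rfl hfm hgm
      have i2 := hN.integrable_exp_neg_add_add hv.le le_rfl ha' hfm hgm
      have i3 := hN.integrable_exp_neg_add_add hv.le ha' ha' hfm hgm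
      simp only [zero_mul, add_zero, integral_const, probReal_univ, one_smul] at e0 e1 e2 i0 i1 i2
      have hadd := integral_laplaceExponentTilde_add_add hM hρ hv.le ha' hfm hgm hf hg hfg
      have hfact : Real.exp (-(M * ∫ x, laplaceExponentTilde M ρ (v + a * f x + a * g x) ∂P)) *
          Real.exp (-(M * laplaceExponentTilde M ρ v)) =
          Real.exp (-(M * ∫ x, laplaceExponentTilde M ρ (v + a * f x) ∂P)) *
          Real.exp (-(M * ∫ x, laplaceExponentTilde M ρ (v + a * g x) ∂P)) := by
        rw [hadd, ← Real.exp_add, ← Real.exp_add]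
        congr 1
        ring
      have hfun : ∀ ω, a⁻¹ * (1 - Real.exp (-(a * weightedSum J θ f ω))) *
          (a⁻¹ * (1 - Real.exp (-(a * weightedSum J θ g ω)))) *
          Real.exp (-(v * weightedSum J θ (fun _ => 1) ω)) =
          a⁻¹ ^ 2 * (Real.exp (-(v * weightedSum J θ (fun _ => 1) ω)) -
            Real.exp (-(v * weightedSum J θ (fun _ => 1) ω + a * weightedSum J θ f ω)) -
            Real.exp (-(v * weightedSum J θ (fun _ => 1) ω + a * weightedSum J θ g ω)) +
            Real.exp (-(v * weightedSum J θ (fun _ => 1) ω + a * weightedSum J θ f ω +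
              a * weightedSum J θ g ω))) := by
        intro ω
        simp only [neg_add, Real.exp_add]
        ring
      rw [integral_congr_ae (.of_forall hfun), integral_const_mul,
        integral_add (by exact (i0.sub i1).sub i2) i3, integral_sub (by exact i0.sub i1) i2,
        integral_sub i0 i1, e0, e1, e2, e3]
      rw [← eq_div_iff hE] at hfact
      rw [hfact]
      field_simp
      ring
    · field_simp

end

/-! ### Moments of normalized weighted sums -/

theorem lintegral_Ioi_mul_exp_neg_mul {s u : ℝ} (hs : 0 < s) (hu : 0 ≤ u) :
    ∫⁻ v in Ioi (0 : ℝ), ENNReal.ofReal (u * Real.exp (-(v * s))) = ENNReal.ofReal (u / s) := by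
  have h := Real.integral_rpow_mul_exp_neg_mul_Ioi one_pos hs
  simp only [sub_self, Real.rpow_zero, one_mul, Real.rpow_one, Real.Gamma_one, mul_one] at h
  have hint : IntegrableOn (fun v => Real.exp (-(s * v))) (Ioi 0) :=
    .of_integral_ne_zero (by rw [h]; positivity)
  simp_rw [mul_comm _ s]
  rw [← ofReal_integral_eq_lintegral_ofReal (hint.const_mul u)
    (.of_forall fun v => mul_nonneg hu (Real.exp_pos _).le), integral_const_mul, h, mul_one_div]

theorem lintegral_Ioi_mul_mul_exp_neg_mul {s u : ℝ} (hs : 0 < s) (hu : 0 ≤ u) :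
    ∫⁻ v in Ioi (0 : ℝ), ENNReal.ofReal (v * (u * Real.exp (-(v * s)))) =
      ENNReal.ofReal (u / s ^ 2) := by
  have h := Real.integral_rpow_mul_exp_neg_mul_Ioi two_pos hs
  simp only [show (2 : ℝ) - 1 = 1 by norm_num, Real.rpow_one, Real.Gamma_two, mul_one,
    Real.rpow_two] at h
  have hint : IntegrableOn (fun v => v * Real.exp (-(s * v))) (Ioi 0) :=
    .of_integral_ne_zero (by rw [h]; positivity)
  simp_rw [mul_comm _ s, mul_left_comm _ u]
  rw [← ofReal_integral_eq_lintegral_ofReal (hint.const_mul u), integral_const_mul, h, one_div,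
    inv_pow, div_eq_mul_inv]
  filter_upwards [ae_restrict_mem measurableSet_Ioi] with v hv
  have : 0 < v := hv
  simp only [Pi.zero_apply]
  positivity

section
variable {Ω : Type*} [MeasurableSpace Ω] {Pr : Measure Ω}

theorem lintegral_div_eq_lintegral_Ioi [SFinite Pr] {U S : Ω → ℝ} (hU : Measurable U)
    (hS : Measurable S) (hU0 : ∀ ω, 0 ≤ U ω) (hS0 : ∀ᵐ ω ∂Pr, 0 < S ω)
    (hint : ∀ v, 0 < v → Integrable (fun ω => U ω * Real.exp (-(v * S ω))) Pr) :
    ∫⁻ ω, ENNReal.ofReal (U ω / S ω) ∂Pr =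
      ∫⁻ v in Ioi (0 : ℝ), ENNReal.ofReal (∫ ω, U ω * Real.exp (-(v * S ω)) ∂Pr) := by
  calc ∫⁻ ω, ENNReal.ofReal (U ω / S ω) ∂Pr
      = ∫⁻ ω, ∫⁻ v in Ioi (0 : ℝ), ENNReal.ofReal (U ω * Real.exp (-(v * S ω))) ∂volume ∂Pr := by
        refine lintegral_congr_ae ?_
        filter_upwards [hS0] with ω hω
        exact (lintegral_Ioi_mul_exp_neg_mul hω (hU0 ω)).symm
    _ = ∫⁻ v in Ioi (0 : ℝ), ∫⁻ ω, ENNReal.ofReal (U ω * Real.exp (-(v * S ω))) ∂Pr := by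
        rw [lintegral_lintegral_swap]
        simp only [Function.uncurry_def]
        fun_prop
    _ = _ := by
        refine setLIntegral_congr_fun measurableSet_Ioi fun v hv => ?_
        exact (ofReal_integral_eq_lintegral_ofReal (hint v hv)
          (.of_forall fun ω => mul_nonneg (hU0 ω) (Real.exp_pos _).le)).symm

theorem lintegral_div_sq_eq_lintegral_Ioi [SFinite Pr] {U S : Ω → ℝ} (hU : Measurable U)
    (hS : Measurable S) (hU0 : ∀ ω, 0 ≤ U ω) (hS0 : ∀ᵐ ω ∂Pr, 0 < S ω)
    (hint : ∀ v, 0 < v → Integrable (fun ω => U ω * Real.exp (-(v * S ω))) Pr) :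
    ∫⁻ ω, ENNReal.ofReal (U ω / S ω ^ 2) ∂Pr =
      ∫⁻ v in Ioi (0 : ℝ), ENNReal.ofReal (v * ∫ ω, U ω * Real.exp (-(v * S ω)) ∂Pr) := by
  calc ∫⁻ ω, ENNReal.ofReal (U ω / S ω ^ 2) ∂Pr
      = ∫⁻ ω, ∫⁻ v in Ioi (0 : ℝ),
          ENNReal.ofReal (v * (U ω * Real.exp (-(v * S ω)))) ∂volume ∂Pr := by
        refine lintegral_congr_ae ?_
        filter_upwards [hS0] with ω hω
        exact (lintegral_Ioi_mul_mul_exp_neg_mul hω (hU0 ω)).symm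
    _ = ∫⁻ v in Ioi (0 : ℝ), ∫⁻ ω, ENNReal.ofReal (v * (U ω * Real.exp (-(v * S ω)))) ∂Pr := by
        rw [lintegral_lintegral_swap]
        simp only [Function.uncurry_def]
        fun_prop
    _ = _ := by
        refine setLIntegral_congr_fun measurableSet_Ioi fun v hv => ?_
        rw [← integral_const_mul]
        exact (ofReal_integral_eq_lintegral_ofReal ((hint v hv).const_mul v)
          (.of_forall fun ω => mul_nonneg (le_of_lt hv)
            (mul_nonneg (hU0 ω) (Real.exp_pos _).le))).symm

end

section
variable {Ω X : Type*} [MeasurableSpace Ω] [MeasurableSpace X] {Pr : Measure Ω}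
  {P : Measure X} {M : ℝ} {ρ : Measure ℝ} {J : ℕ → Ω → ℝ} {θ : ℕ → Ω → X}

theorem IsPoissonProcess.ae_weightedSum_one_pos [IsProbabilityMeasure Pr] [IsProbabilityMeasure P]
    (hN : IsPoissonProcess Pr (fun k ω => (J k ω, θ k ω)) (levyMeasure M ρ P))
    (hρ : IntegrableOn (fun t : ℝ => t) (Ioi 0) ρ) :
    ∀ᵐ ω ∂Pr, 0 < weightedSum J θ (fun _ => 1) ω := by
  filter_upwards [hN.ae_tsum_ofReal_mem_Ioo hρ] with ω hω
  exact ENNReal.toReal_pos (by simpa using hω.1.ne') (by simpa using hω.2.ne)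

theorem lintegral_weightedSum_div_eq_mul [IsProbabilityMeasure Pr] [IsProbabilityMeasure P]
    (hM : 0 < M) (hρ : IntegrableOn (fun t : ℝ => t) (Ioi 0) ρ)
    (hN : IsPoissonProcess Pr (fun k ω => (J k ω, θ k ω)) (levyMeasure M ρ P))
    {f : X → ℝ} (hfm : Measurable f) (hf : ∀ x, f x ∈ Icc 0 1) :
    ∫⁻ ω, ENNReal.ofReal (weightedSum J θ f ω / weightedSum J θ (fun _ => 1) ω) ∂Pr =
      ENNReal.ofReal (∫ x, f x ∂P) * ∫⁻ v in Ioi (0 : ℝ),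
        ENNReal.ofReal (Real.exp (-(M * laplaceExponentTilde M ρ v)) *
          (M * deriv (laplaceExponentTilde M ρ) v)) := by
  have hSm := hN.measurable_weightedSum (w := fun _ => 1) measurable_const
  have hUm := hN.measurable_weightedSum hfm
  rw [lintegral_div_eq_lintegral_Ioi hUm hSm (weightedSum_nonneg f) (hN.ae_weightedSum_one_pos hρ),
    ← lintegral_const_mul]
  · refine setLIntegral_congr_fun measurableSet_Ioi fun v hv => ?_
    rw [integral_weightedSum_mul_exp hM hρ hN hv hfm hf,
      ← ENNReal.ofReal_mul (integral_nonneg fun x => (hf x).1)]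
    congr 1
    ring
  · have := measurable_laplaceExponentTilde (M := M) hρ
    have := measurable_deriv (laplaceExponentTilde M ρ)
    fun_prop
  · intro v hv
    refine Integrable.of_bound (by fun_prop) (1 / v) ?_
    filter_upwards [hN.ae_tsum_ofReal_mem_Ioo hρ] with ω hω
    rw [Real.norm_of_nonneg (mul_nonneg (weightedSum_nonneg f ω) (Real.exp_pos _).le)]
    refine le_trans ?_ (mul_exp_neg_mul_le (s := weightedSum J θ (fun _ => 1) ω) hv)
    gcongr
    exact weightedSum_le (fun x => (hf x).2) hω.2.ne

/-- The mean of a normalized weighted sum. The case `f = 1` shows that the factor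
`∫ M ψ̃'(v) e^{-Mψ̃(v)} dv` is `1`. -/
theorem lintegral_weightedSum_div [IsProbabilityMeasure Pr] [IsProbabilityMeasure P]
    (hM : 0 < M) (hρ : IntegrableOn (fun t : ℝ => t) (Ioi 0) ρ)
    (hN : IsPoissonProcess Pr (fun k ω => (J k ω, θ k ω)) (levyMeasure M ρ P))
    {f : X → ℝ} (hfm : Measurable f) (hf : ∀ x, f x ∈ Icc 0 1) :
    ∫⁻ ω, ENNReal.ofReal (weightedSum J θ f ω / weightedSum J θ (fun _ => 1) ω) ∂Pr =
      ENNReal.ofReal (∫ x, f x ∂P) := by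
  have h1 := lintegral_weightedSum_div_eq_mul hM hρ hN (f := fun _ => 1) measurable_const
    fun _ => by simp
  have h2 : ∫⁻ ω, ENNReal.ofReal (weightedSum J θ (fun _ => 1) ω /
      weightedSum J θ (fun _ => 1) ω) ∂Pr = 1 := by
    rw [← measure_univ (μ := Pr), ← lintegral_one]
    refine lintegral_congr_ae ?_
    filter_upwards [hN.ae_weightedSum_one_pos hρ] with ω hω
    rw [div_self hω.ne', ENNReal.ofReal_one]
  rw [h2, integral_const, probReal_univ, one_smul, ENNReal.ofReal_one, one_mul] at h1
  rw [lintegral_weightedSum_div_eq_mul hM hρ hN hfm hf, ← h1, mul_one]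

/-- The mixed second moment of normalized weighted sums; there is no diagonal term because
`f g = 0` almost everywhere. -/
theorem lintegral_weightedSum_mul_weightedSum_div_sq [IsProbabilityMeasure Pr]
    [IsProbabilityMeasure P]
    (hM : 0 < M) (hρ : IntegrableOn (fun t : ℝ => t) (Ioi 0) ρ)
    (hN : IsPoissonProcess Pr (fun k ω => (J k ω, θ k ω)) (levyMeasure M ρ P))
    {f g : X → ℝ} (hfm : Measurable f) (hgm : Measurable g)
    (hf : ∀ x, f x ∈ Icc 0 1) (hg : ∀ x, g x ∈ Icc 0 1) (hfg : ∀ᵐ x ∂P, f x = 0 ∨ g x = 0) :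
    ∫⁻ ω, ENNReal.ofReal (weightedSum J θ f ω * weightedSum J θ g ω /
        weightedSum J θ (fun _ => 1) ω ^ 2) ∂Pr =
      ENNReal.ofReal ((∫ x, f x ∂P) * (∫ x, g x ∂P) * (M ^ 2 * ∫ v in Ioi (0 : ℝ),
        v * (deriv (laplaceExponentTilde M ρ) v ^ 2 *
          Real.exp (-(M * laplaceExponentTilde M ρ v))))) := by
  have hSm := hN.measurable_weightedSum (w := fun _ => 1) measurable_const
  have hUm := hN.measurable_weightedSum hfm
  have hWm := hN.measurable_weightedSum hgm
  have hf0 : 0 ≤ ∫ x, f x ∂P := integral_nonneg fun x => (hf x).1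
  have hg0 : 0 ≤ ∫ x, g x ∂P := integral_nonneg fun x => (hg x).1
  have hUWm : Measurable fun ω => weightedSum J θ f ω * weightedSum J θ g ω := hUm.mul hWm
  rw [lintegral_div_sq_eq_lintegral_Ioi hUWm hSm
    (fun ω => mul_nonneg (weightedSum_nonneg f ω) (weightedSum_nonneg g ω))
    (hN.ae_weightedSum_one_pos hρ), ← mul_assoc, ← integral_const_mul,
    ofReal_integral_eq_lintegral_ofReal ((integrableOn_mul_deriv_sq_mul_exp hM hρ).const_mul _)]
  · refine setLIntegral_congr_fun measurableSet_Ioi fun v hv => ?_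
    rw [integral_weightedSum_mul_weightedSum_mul_exp hM hρ hN hv hfm hgm hf hg hfg]
    congr 1
    ring
  · filter_upwards [ae_restrict_mem measurableSet_Ioi] with v hv
    have : 0 < v := hv
    simp only [Pi.zero_apply]
    positivity
  · intro v hv
    refine Integrable.of_bound (by fun_prop) (2 / v ^ 2) ?_
    filter_upwards [hN.ae_tsum_ofReal_mem_Ioo hρ] with ω hω
    have hU := weightedSum_nonneg (J := J) (θ := θ) f ω
    have hW := weightedSum_nonneg (J := J) (θ := θ) g ω
    have hS := weightedSum_nonneg (J := J) (θ := θ) (fun _ => 1) ω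
    rw [Real.norm_of_nonneg (mul_nonneg (mul_nonneg hU hW) (Real.exp_pos _).le)]
    refine le_trans ?_ (sq_mul_exp_neg_mul_le hv hS)
    rw [sq]
    refine mul_le_mul_of_nonneg_right (mul_le_mul ?_ ?_ hW hS) (Real.exp_pos _).le
    · exact weightedSum_le (fun x => (hf x).2) hω.2.ne
    · exact weightedSum_le (fun x => (hg x).2) hω.2.ne

end

/-! ### The point transition -/

section
variable {Ω X : Type*} {J : ℕ → Ω → ℝ} {θ : ℕ → Ω → X}

/-- The integral `∑ₖ rₖ f(θₖ)` of `f` under the normalized random measure. -/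
theorem tsum_normalizedJump_mul {f : X → ℝ} (hf : ∀ x, f x ∈ Icc 0 1) {ω : Ω}
    (hω : ∑' k, ENNReal.ofReal (J k ω) ∈ Ioo 0 ∞) :
    ∑' k, normalizedJump J k ω * ENNReal.ofReal (f (θ k ω)) =
      ENNReal.ofReal (weightedSum J θ f ω / weightedSum J θ (fun _ => 1) ω) := by
  have hfin : ∑' k, ENNReal.ofReal (J k ω) * ENNReal.ofReal (f (θ k ω)) ≠ ∞ := by
    refine ne_top_of_le_ne_top hω.2.ne (ENNReal.tsum_le_tsum fun k => mul_le_of_le_one_right' ?_)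
    exact ENNReal.ofReal_le_one.2 (hf _).2
  rw [ENNReal.ofReal_div_of_pos]
  · simp only [weightedSum, ENNReal.ofReal_one, mul_one]
    rw [ENNReal.ofReal_toReal hfin, ENNReal.ofReal_toReal hω.2.ne, ENNReal.div_eq_inv_mul,
      ← ENNReal.tsum_mul_left]
    refine tsum_congr fun k => ?_
    rw [normalizedJump, ENNReal.div_eq_inv_mul, mul_assoc]
  · exact ENNReal.toReal_pos (by simpa using hω.1.ne') (by simpa using hω.2.ne)

theorem tsum_normalizedJump_le_one {Ω : Type*} {J : ℕ → Ω → ℝ} (ω : Ω) :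
    ∑' k, normalizedJump J k ω ≤ 1 := by
  simp only [normalizedJump, ENNReal.div_eq_inv_mul]
  rw [ENNReal.tsum_mul_left]
  exact ENNReal.inv_mul_le_one _

end

section
variable {Ω X : Type*} [MeasurableSpace X] {J : ℕ → Ω → ℝ} {θ : ℕ → Ω → X}

theorem nrm_apply_eq_tsum (ω : Ω) {B : Set X} (hB : MeasurableSet B) :
    nrm J θ ω B =
      ∑' k, normalizedJump J k ω * ENNReal.ofReal (B.indicator (1 : X → ℝ) (θ k ω)) := by
  rw [nrm_eq_atomicMeasure, atomicMeasure, Measure.sum_apply _ hB]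
  refine tsum_congr fun k => ?_
  rw [Measure.smul_apply, Measure.dirac_apply' _ hB, smul_eq_mul]
  by_cases h : θ k ω ∈ B <;> simp [h]

theorem transitionNrm_apply_eq_tsum {θ' : ℕ → Ω → X} (ω : Ω) {B : Set X} (hB : MeasurableSet B) :
    transitionNrm J θ' ω B = ∑' k, normalizedJump J k ω * B.indicator 1 (θ' k ω) := by
  rw [transitionNrm, atomicMeasure, Measure.sum_apply _ hB]
  refine tsum_congr fun k => ?_
  rw [Measure.smul_apply, Measure.dirac_apply' _ hB, smul_eq_mul]

theorem nrm_apply_le_one (ω : Ω) (B : Set X) : nrm J θ ω B ≤ 1 := by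
  refine (measure_mono (subset_univ B)).trans ?_
  rw [nrm, Measure.smul_apply, smul_eq_mul]
  exact ENNReal.inv_mul_le_one _

theorem transitionNrm_apply_le_one {θ' : ℕ → Ω → X} (ω : Ω) (B : Set X) :
    transitionNrm J θ' ω B ≤ 1 := by
  refine (measure_mono (subset_univ B)).trans ?_
  rw [transitionNrm_apply_eq_tsum ω .univ]
  simpa using tsum_normalizedJump_le_one ω

end

section
variable {Ω X : Type*} [MeasurableSpace Ω] [MeasurableSpace X] {Pr : Measure Ω}
  {J : ℕ → Ω → ℝ} {θ : ℕ → Ω → X}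
  {𝒯 : Kernel X X} {θ' : ℕ → Ω → X}

/-- Conditional on the points, a location `θ' k` is distributed as `𝒯 (θ k, ·)`: a function `G` of
the points may be integrated against the conditional probability of `θ' k ∈ D`. -/
theorem IsPointTransition.lintegral_mul_indicator [IsFiniteMeasure Pr]
    (hT : IsPointTransition Pr J θ 𝒯 θ') (hJ : ∀ k, Measurable (J k)) (hθ : ∀ k, Measurable (θ k))
    {G : (ℕ → ℝ × X) → ℝ≥0∞} (hG : Measurable G) (k : ℕ) {D : Set X} (hD : MeasurableSet D) :
    ∫⁻ ω, G (fun k => (J k ω, θ k ω)) * D.indicator 1 (θ' k ω) ∂Pr =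
      ∫⁻ ω, G (fun k => (J k ω, θ k ω)) * 𝒯 (θ k ω) D ∂Pr := by
  have hZ : Measurable fun ω => fun k => (J k ω, θ k ω) :=
    measurable_pi_lambda _ fun k => (hJ k).prodMk (hθ k)
  have h𝒯 : Measurable fun ω => 𝒯 (θ k ω) D := (𝒯.measurable_coe hD).comp (hθ k)
  have hS : MeasurableSet {ω | θ' k ω ∈ D} := hT.measurable k hD
  have hmap : (Pr.restrict {ω | θ' k ω ∈ D}).map (fun ω => fun k => (J k ω, θ k ω)) =
      (Pr.withDensity fun ω => 𝒯 (θ k ω) D).map (fun ω => fun k => (J k ω, θ k ω)) := by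
    ext C hC
    have h := hT.law C hC {k} (fun _ => D) fun _ => hD
    simp only [Finset.mem_singleton, iInter_iInter_eq_left, Finset.prod_singleton] at h
    rw [Measure.map_apply hZ hC, Measure.map_apply hZ hC, withDensity_apply _ (hZ hC),
      Measure.restrict_apply (hZ hC)]
    exact h
  calc ∫⁻ ω, G (fun k => (J k ω, θ k ω)) * D.indicator 1 (θ' k ω) ∂Pr
      = ∫⁻ ω in {ω | θ' k ω ∈ D}, G (fun k => (J k ω, θ k ω)) ∂Pr := by
        rw [← lintegral_indicator hS]
        refine lintegral_congr fun ω => ?_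
        by_cases h : θ' k ω ∈ D <;> simp [h]
    _ = ∫⁻ ω, G (fun k => (J k ω, θ k ω)) ∂(Pr.withDensity fun ω => 𝒯 (θ k ω) D) := by
        rw [← lintegral_map hG hZ, hmap, lintegral_map hG hZ]
    _ = _ := by
        rw [lintegral_withDensity_eq_lintegral_mul _ h𝒯
          (show Measurable fun ω => G (fun k => (J k ω, θ k ω)) from hG.comp hZ)]
        simp only [Pi.mul_apply, mul_comm]

/-- Given the points, `Tμ(D)` has conditional mean `∑ₖ rₖ 𝒯(θₖ, D)`. -/
theorem IsPointTransition.lintegral_mul_transitionNrm [IsFiniteMeasure Pr]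
    (hT : IsPointTransition Pr J θ 𝒯 θ') (hJ : ∀ k, Measurable (J k)) (hθ : ∀ k, Measurable (θ k))
    {G : (ℕ → ℝ × X) → ℝ≥0∞} (hG : Measurable G) {D : Set X} (hD : MeasurableSet D) :
    ∫⁻ ω, G (fun k => (J k ω, θ k ω)) * transitionNrm J θ' ω D ∂Pr =
      ∫⁻ ω, G (fun k => (J k ω, θ k ω)) * ∑' k, normalizedJump J k ω * 𝒯 (θ k ω) D ∂Pr := by
  have hZ : Measurable fun ω => fun k => (J k ω, θ k ω) :=
    measurable_pi_lambda _ fun k => (hJ k).prodMk (hθ k)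
  let r : ℕ → (ℕ → ℝ × X) → ℝ≥0∞ := fun k z =>
    ENNReal.ofReal (z k).1 / ∑' j, ENNReal.ofReal (z j).1
  have hr : ∀ k, Measurable (r k) := fun k =>
    (measurable_pi_apply k).fst.ennreal_ofReal.div
      (Measurable.tsum fun j => (measurable_pi_apply j).fst.ennreal_ofReal)
  have hGr : ∀ k, Measurable fun z => G z * r k z := fun k => hG.mul (hr k)
  have h𝒯 : ∀ k, Measurable fun ω => 𝒯 (θ k ω) D := fun k => (𝒯.measurable_coe hD).comp (hθ k)
  have hind : ∀ k, Measurable fun ω => D.indicator (1 : X → ℝ≥0∞) (θ' k ω) := fun k =>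
    (measurable_one.indicator hD).comp (hT.measurable k)
  simp_rw [transitionNrm_apply_eq_tsum _ hD, ← ENNReal.tsum_mul_left, ← mul_assoc]
  rw [lintegral_tsum fun k => by exact (((hGr k).comp hZ).mul (hind k)).aemeasurable,
    lintegral_tsum fun k => by exact (((hGr k).comp hZ).mul (h𝒯 k)).aemeasurable]
  exact tsum_congr fun k => hT.lintegral_mul_indicator hJ hθ (hGr k) k hD

end

end

/-! ### The covariance formula -/

theorem transformedBase_real_apply {X : Type*} [MeasurableSpace X] (𝒯 : Kernel X X)
    [IsMarkovKernel 𝒯] (P : Measure X) {D : Set X} (hD : MeasurableSet D) :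
    (transformedBase 𝒯 P).real D = ∫ x, (𝒯 x).real D ∂P := by
  rw [measureReal_def, transformedBase_apply 𝒯 P hD]
  exact (integral_toReal (𝒯.measurable_coe hD).aemeasurable
    (.of_forall fun x => measure_lt_top _ _)).symm

/-- The covariance formula under the weaker assumption that no point of `B` is moved into `B`, with
the inner integral of the double integral evaluated. -/
theorem covariance_nrm_transitionNrm {Ω X : Type*} [MeasurableSpace Ω] [MeasurableSpace X]
    {Pr : Measure Ω} [IsProbabilityMeasure Pr] {P : Measure X} [IsProbabilityMeasure P]
    {M : ℝ} (hM : 0 < M) {ρ : Measure ℝ} (hρ : IntegrableOn (fun t : ℝ => t) (Ioi 0) ρ)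
    {J : ℕ → Ω → ℝ} {θ : ℕ → Ω → X}
    (hN : IsPoissonProcess Pr (fun k ω => (J k ω, θ k ω)) (levyMeasure M ρ P))
    {𝒯 : Kernel X X} [IsMarkovKernel 𝒯] {θ' : ℕ → Ω → X}
    (hT : IsPointTransition Pr J θ 𝒯 θ') {B : Set X} (hB : MeasurableSet B)
    (hBB : ∀ᵐ y ∂P, y ∈ B → 𝒯 y B = 0) :
    cov[fun ω => (nrm J θ ω).real B, fun ω => (transitionNrm J θ' ω).real B; Pr] =
      (transformedBase 𝒯 P).real B * P.real B *
        (M ^ 2 * (∫ v in Ioi (0 : ℝ), v * (deriv (laplaceExponentTilde M ρ) v ^ 2 *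
          Real.exp (-(M * laplaceExponentTilde M ρ v)))) - 1) := by
  have hJ : ∀ k, Measurable (J k) := fun k => (hN.measurable k).fst
  have hθ : ∀ k, Measurable (θ k) := fun k => (hN.measurable k).snd
  let f : X → ℝ := B.indicator 1
  let g : X → ℝ := fun x => (𝒯 x).real B
  have hfm : Measurable f := measurable_one.indicator hB
  have hgm : Measurable g := (𝒯.measurable_coe hB).ennreal_toReal
  have hf : ∀ x, f x ∈ Icc 0 1 := fun x => by
    by_cases h : x ∈ B <;> simp [f, h]
  have hg : ∀ x, g x ∈ Icc 0 1 := fun x => ⟨measureReal_nonneg, measureReal_le_one⟩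
  have hfg : ∀ᵐ x ∂P, f x = 0 ∨ g x = 0 := by
    filter_upwards [hBB] with x hx
    by_cases h : x ∈ B
    · exact .inr (by simp [g, measureReal_def, hx h])
    · exact .inl (by simp [f, h])
  have hfint : ∫ x, f x ∂P = P.real B := by simp [f, integral_indicator_one hB]
  have hgint : ∫ x, g x ∂P = (transformedBase 𝒯 P).real B :=
    (transformedBase_real_apply 𝒯 P hB).symm
  -- `μ(B)` is a measurable function of the points
  let G : (ℕ → ℝ × X) → ℝ≥0∞ := fun z => ∑' k,
    ENNReal.ofReal (z k).1 / (∑' j, ENNReal.ofReal (z j).1) * ENNReal.ofReal (f (z k).2)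
  have hGm : Measurable G := Measurable.tsum fun k =>
    ((measurable_pi_apply k).fst.ennreal_ofReal.div
      (Measurable.tsum fun j => (measurable_pi_apply j).fst.ennreal_ofReal)).mul
      (hfm.comp (measurable_pi_apply k).snd).ennreal_ofReal
  have hG : ∀ ω, nrm J θ ω B = G fun k => (J k ω, θ k ω) := fun ω => nrm_apply_eq_tsum ω hB
  have hnm : Measurable fun ω => nrm J θ ω B := by
    simp_rw [hG]
    exact hGm.comp (measurable_pi_lambda _ fun k => (hJ k).prodMk (hθ k))
  have htm : Measurable fun ω => transitionNrm J θ' ω B := by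
    simp_rw [transitionNrm_apply_eq_tsum _ hB, normalizedJump]
    exact Measurable.tsum fun k => ((hJ k).ennreal_ofReal.div
      (Measurable.tsum fun j => (hJ j).ennreal_ofReal)).mul
        ((measurable_one.indicator hB).comp (hT.measurable k))
  have hn : ∀ᵐ ω ∂Pr, nrm J θ ω B =
      ENNReal.ofReal (weightedSum J θ f ω / weightedSum J θ (fun _ => 1) ω) := by
    filter_upwards [hN.ae_tsum_ofReal_mem_Ioo hρ] with ω hω
    rw [nrm_apply_eq_tsum ω hB, ← tsum_normalizedJump_mul hf hω]
  have ht : ∀ᵐ ω ∂Pr, ∑' k, normalizedJump J k ω * 𝒯 (θ k ω) B =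
      ENNReal.ofReal (weightedSum J θ g ω / weightedSum J θ (fun _ => 1) ω) := by
    filter_upwards [hN.ae_tsum_ofReal_mem_Ioo hρ] with ω hω
    rw [← tsum_normalizedJump_mul hg hω]
    simp only [g, ofReal_measureReal (measure_ne_top _ _)]
  have e1 : ∫⁻ ω, nrm J θ ω B ∂Pr = ENNReal.ofReal (∫ x, f x ∂P) := by
    rw [lintegral_congr_ae hn, lintegral_weightedSum_div hM hρ hN hfm hf]
  have e2 : ∫⁻ ω, transitionNrm J θ' ω B ∂Pr = ENNReal.ofReal (∫ x, g x ∂P) := by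
    have h := hT.lintegral_mul_transitionNrm hJ hθ (G := fun _ => 1) measurable_const hB
    simp only [one_mul] at h
    rw [h, lintegral_congr_ae ht, lintegral_weightedSum_div hM hρ hN hgm hg]
  have e3 : ∫⁻ ω, nrm J θ ω B * transitionNrm J θ' ω B ∂Pr =
      ENNReal.ofReal ((∫ x, f x ∂P) * (∫ x, g x ∂P) * (M ^ 2 * ∫ v in Ioi (0 : ℝ),
        v * (deriv (laplaceExponentTilde M ρ) v ^ 2 *
          Real.exp (-(M * laplaceExponentTilde M ρ v))))) := by
    rw [← lintegral_weightedSum_mul_weightedSum_div_sq hM hρ hN hfm hgm hf hg hfg]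
    simp_rw [hG]
    rw [hT.lintegral_mul_transitionNrm hJ hθ hGm hB]
    refine lintegral_congr_ae ?_
    filter_upwards [hn, ht] with ω h1 h2
    rw [← hG, h1, h2, ← ENNReal.ofReal_mul (div_nonneg (weightedSum_nonneg _ _)
      (weightedSum_nonneg _ _)), div_mul_div_comm, sq]
  have hI : 0 ≤ ∫ v in Ioi (0 : ℝ), v * (deriv (laplaceExponentTilde M ρ) v ^ 2 *
      Real.exp (-(M * laplaceExponentTilde M ρ v))) :=
    setIntegral_nonneg measurableSet_Ioi fun v hv => by
      have : 0 < v := hv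
      positivity
  have hf0 : 0 ≤ ∫ x, f x ∂P := integral_nonneg fun x => (hf x).1
  have hg0 : 0 ≤ ∫ x, g x ∂P := integral_nonneg fun x => (hg x).1
  have hlt1 : ∀ ω, nrm J θ ω B < ∞ := fun ω => (nrm_apply_le_one ω B).trans_lt ENNReal.one_lt_top
  have hlt2 : ∀ ω, transitionNrm J θ' ω B < ∞ := fun ω =>
    (transitionNrm_apply_le_one ω B).trans_lt ENNReal.one_lt_top
  have m1 : MemLp (fun ω => (nrm J θ ω).real B) 2 Pr :=
    .of_bound hnm.ennreal_toReal.aestronglyMeasurable 1 (.of_forall fun ω => by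
      rw [Real.norm_of_nonneg measureReal_nonneg]
      exact ENNReal.toReal_le_of_le_ofReal zero_le_one (by simpa using nrm_apply_le_one ω B))
  have m2 : MemLp (fun ω => (transitionNrm J θ' ω).real B) 2 Pr :=
    .of_bound htm.ennreal_toReal.aestronglyMeasurable 1 (.of_forall fun ω => by
      rw [Real.norm_of_nonneg measureReal_nonneg]
      exact ENNReal.toReal_le_of_le_ofReal zero_le_one
        (by simpa using transitionNrm_apply_le_one ω B))
  have r1 : ∫ ω, (nrm J θ ω).real B ∂Pr = ∫ x, f x ∂P := by
    rw [← ENNReal.toReal_ofReal hf0, ← e1]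
    exact integral_toReal hnm.aemeasurable (.of_forall hlt1)
  have r2 : ∫ ω, (transitionNrm J θ' ω).real B ∂Pr = ∫ x, g x ∂P := by
    rw [← ENNReal.toReal_ofReal hg0, ← e2]
    exact integral_toReal htm.aemeasurable (.of_forall hlt2)
  have r3 : ∫ ω, (nrm J θ ω).real B * (transitionNrm J θ' ω).real B ∂Pr =
      (∫ x, f x ∂P) * (∫ x, g x ∂P) * (M ^ 2 * ∫ v in Ioi (0 : ℝ),
        v * (deriv (laplaceExponentTilde M ρ) v ^ 2 *
          Real.exp (-(M * laplaceExponentTilde M ρ v)))) := by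
    rw [← ENNReal.toReal_ofReal (mul_nonneg (mul_nonneg hf0 hg0) (mul_nonneg (sq_nonneg M) hI)),
      ← e3, ← integral_toReal (by exact (hnm.mul htm).aemeasurable)
        (.of_forall fun ω => ENNReal.mul_lt_top (hlt1 ω) (hlt2 ω))]
    simp only [measureReal_def, ENNReal.toReal_mul]
  rw [covariance_eq_sub m1 m2]
  simp only [Pi.mul_apply]
  rw [r1, r2, r3, hfint, hgint]
  ring

theorem mainTheorem4 {Ω X : Type*} [MeasurableSpace Ω] [MeasurableSpace X]
    (Pr : Measure Ω) [IsProbabilityMeasure Pr]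
    (P : Measure X) [IsProbabilityMeasure P]
    (M : ℝ) (hM : 0 < M)
    (ρ : Measure ℝ) (hρ_infinite : ρ (Ioi 0) = ∞)
    (hρ_mean : ∫⁻ t in Ioi (0 : ℝ), ENNReal.ofReal t ∂ρ < ∞)
    (J : ℕ → Ω → ℝ) (θ : ℕ → Ω → X)
    (hN : IsPoissonProcess Pr (fun k ω => (J k ω, θ k ω)) (levyMeasure M ρ P))
    (𝒯 : Kernel X X) [IsMarkovKernel 𝒯]
    (θ' : ℕ → Ω → X) (hT : IsPointTransition Pr J θ 𝒯 θ')
    (A B : Set X) (hA : MeasurableSet A) (hB : MeasurableSet B) (hAB : Disjoint A B)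
    (hBA : ∀ᵐ y ∂P, y ∈ B → 𝒯 y A = 1) :
    -- the quantities in the formula are well defined
    (∀ v : ℝ, 0 < v → DifferentiableAt ℝ (laplaceExponentTilde M ρ) v) ∧
    IntegrableOn (fun v₂ : ℝ => ∫ _v₁ in (0 : ℝ)..v₂,
      deriv (laplaceExponentTilde M ρ) v₂ ^ 2 *
        Real.exp (-(M * laplaceExponentTilde M ρ v₂))) (Ioi 0) ∧
    -- the covariance formula
    cov[fun ω => (nrm J θ ω).real B, fun ω => (transitionNrm J θ' ω).real B; Pr] =
      (transformedBase 𝒯 P).real B * P.real B *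
        (M ^ 2 * (∫ v₂ in Ioi (0 : ℝ), ∫ _v₁ in (0 : ℝ)..v₂,
          deriv (laplaceExponentTilde M ρ) v₂ ^ 2 *
            Real.exp (-(M * laplaceExponentTilde M ρ v₂))) - 1) ∧
    -- the case in which the points moved into `B` are exactly those of a set `C`
    (∀ C : Set X, MeasurableSet C → (∀ᵐ x ∂P, 𝒯 x B = C.indicator 1 x) →
      cov[fun ω => (nrm J θ ω).real B, fun ω => (transitionNrm J θ' ω).real B; Pr] =
        P.real C * P.real B *
          (M ^ 2 * (∫ v₂ in Ioi (0 : ℝ), ∫ _v₁ in (0 : ℝ)..v₂,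
            deriv (laplaceExponentTilde M ρ) v₂ ^ 2 *
              Real.exp (-(M * laplaceExponentTilde M ρ v₂))) - 1)) := by
  have hρ : IntegrableOn (fun t : ℝ => t) (Ioi 0) ρ := by
    refine ⟨measurable_id.aestronglyMeasurable, ?_⟩
    rw [hasFiniteIntegral_iff_ofReal]
    · exact hρ_mean
    · filter_upwards [ae_restrict_mem measurableSet_Ioi] with t ht using le_of_lt ht
  have hBB : ∀ᵐ y ∂P, y ∈ B → 𝒯 y B = 0 := by
    filter_upwards [hBA] with y hy hyB
    exact measure_mono_null hAB.symm.subset_compl_right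
      ((prob_compl_eq_zero_iff hA).2 (hy hyB))
  have hcov := covariance_nrm_transitionNrm hM hρ hN hT hB hBB
  -- the integrand does not depend on `v₁`, so the inner integral is multiplication by `v₂`
  simp only [intervalIntegral.integral_const, sub_zero, smul_eq_mul]
  refine ⟨fun v hv => (hasDerivAt_laplaceExponentTilde hM.ne' hρ hv).2.differentiableAt,
    integrableOn_mul_deriv_sq_mul_exp hM hρ, hcov, fun C hC hBC => ?_⟩
  rw [hcov, measureReal_def (transformedBase 𝒯 P), transformedBase_apply 𝒯 P hB,
    lintegral_congr_ae hBC, lintegral_indicator_one hC, ← measureReal_def]
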